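/- **Setting.** Let $f$ be a log-concave probability density on $\mathbb R$, i.e. $\log f:\mathbb R\to[-\infty,\infty)$ is concave, let $X_1,\dots,X_n$ be i.i.d. with density $f$ and order statistics $X_{(1)}\le\dots\le X_{(n)}$, and let $\alpha\in(0,1)$. Put $s_n=\lceil\log_2\log n\rceil$, $m=\lfloor (n-1)/2^{s_n}\rfloor+1$, $x_i=X_{(1+(i-1)2^{s_n})}$ for $i=1,\dots,m$, $B_{\max}=\lfloor\log_2(n/8)\rfloor-s_n$ and $t_n=\sum_{B=0}^{B_{\max}}\frac1{B+2}$. For $0\le B\le B_{\max}$ put $n_B=\lfloor (n-1)/2^{B+s_n}\rfloor$, $\mathcal I_B=\{(1+(i-1)2^B,\,1+i2^B): i=1,\dots,n_B\}$, and let $c_B$ and $d_B$ be the $\frac{\alpha}{2(B+2)n_Bt_n}$- and the $\bigl(1-\frac{\alpha}{2(B+2)n_Bt_n}\bigr)$-quantile of the beta distribution with parameters $2^{B+s_n}$ and $n+1-2^{B+s_n}$. With $E(s)=\int_0^1e^{st}\,dt$ and $\delta_i=x_{i+1}-x_i$, define for real vectors $(\ell_1,\dots,\ell_m)$ and $(g_1,\dots,g_{m-1})$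 $$L_i=\delta_ie^{\ell_i}E(\ell_{i+1}-\ell_i),\qquad P_i=\delta_ie^{\ell_i}E(g_i\delta_i),\qquad Q_i=\delta_ie^{\ell_{i+1}}E(-g_{i+1}\delta_i),$$ and $U_{m-1}=P_{m-1}$, $U_i=Q_i$ for $i\le m-2$, $V_1=Q_1$, $V_i=P_i$ for $2\le i\le m-1$. Call $(\ell,g)$ *feasible* if $\ell_j\le\ell_i+g_i(x_j-x_i)$ for all $2\le i\le m-1$ and $j\in\{i-1,i+1\}$, and if for all $0\le B\le B_{\max}$ and $(j,k)\in\mathcal I_B$ $$c_B\le\sum_{i=j}^{k-1}U_i,\qquad c_B\le\sum_{i=j}^{k-1}V_i,\qquad \sum_{i=j}^{k-1}L_i\le d_B .$$ Suppose that a feasible point exists, and let $\lambda_i$ and $\mu_i$ be the infimum and the supremum of $\ell_i$ over all feasible $(\ell,g)$. For $x\in[x_i,x_{i+1})$, $1\le i\le m-1$, let $\lambda(x)=\lambda_i+(x-x_i)\frac{\lambda_{i+1}-\lambda_i}{x_{i+1}-x_i}$, and let $\lambda(x)=-\infty$ for all other $x$. Let $$\mathcal L_k=\min_{j<k}\frac{\mu_k-\lambda_j}{x_k-x_j},\qquad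 \mathcal R_k=\max_{j>k}\frac{\lambda_j-\mu_k}{x_j-x_k},$$ and, with $x_0=-\infty$, $x_{m+1}=\infty$, let $$\mu(x)=\begin{cases}\mu_{i+1}+\mathcal R_{i+1}(x-x_{i+1}), & x\in(x_i,x_{i+1}),\ i\in\{0,1\},\\ \min\bigl(\mu_i+\mathcal L_i(x-x_i),\ \mu_{i+1}+\mathcal R_{i+1}(x-x_{i+1})\bigr), & x\in[x_i,x_{i+1}),\ 2\le i\le m-2,\\ \mu_i+\mathcal L_i(x-x_i), & x\in[x_i,x_{i+1}),\ i\in\{m-1,m\},\end{cases}$$ and $\mu(x_1)=\mu_1$. The confidence band for $f$ is given by $\hat\ell(x)=e^{\lambda(x)}$ and $\hat u(x)=e^{\mu(x)}$; it is defined whenever a feasible point exists. **Theorem.** Let $f$ be a log-concave density such that $f>0$ and $\log f$ is affine on an interval $J\subseteq\mathbb R$. Then for every bounded closed interval $I\subset\operatorname{int}J$ there is a constant $C>0$, depending only on $f$, $I$ and $J$, such that for every $\alpha\in(0,1)$, as $n\to\infty$, $$\mathbb P_f\Bigl\{\text{a feasible point exists and }\sup_{x\in I}|\hat u(x)-f(x)|>C\sqrt{\tfrac{\log\log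 n}{n}}\Bigr\}\to0,$$ $$\mathbb P_f\Bigl\{\text{a feasible point exists and }\sup_{x\in I}|\hat\ell(x)-f(x)|>C\sqrt{\tfrac{\log\log n}{n}}\Bigr\}\to0,$$ $$\mathbb P_f\Bigl\{\text{a feasible point exists and }\sup_{x\in I}\bigl(\hat u(x)-\hat\ell(x)\bigr)>2C\sqrt{\tfrac{\log\log n}{n}}\Bigr\}\to0 .$$ In other words, with probability tending to $1$ the confidence band, whenever it is defined, satisfies all three bounds. -/

import Mathlib

open Set Filter Topology MeasureTheory

noncomputable section

/-! ### Log-concave densities and i.i.d. samples -/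

/-- `f` is a log-concave probability density on `ℝ`: `f ≥ 0`, `∫ f = 1`, and `log f` is concave as a
function with values in `[-∞, ∞)`, i.e. `{f > 0}` is convex and `log f` is concave on it. -/
structure IsLogConcaveDensity (f : ℝ → ℝ) : Prop where
  nonneg : ∀ x, 0 ≤ f x
  concaveOn_log : ConcaveOn ℝ {x | 0 < f x} (fun x => Real.log (f x))
  integrable : Integrable f volume
  integral_eq_one : ∫ x, f x = 1

/-- The joint law of `n` i.i.d. observations with density `f`. -/
def sampleLaw (f : ℝ → ℝ) (n : ℕ) : Measure (Fin n → ℝ) :=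
  Measure.pi fun _ => volume.withDensity fun x => ENNReal.ofReal (f x)

/-- The `j`-th order statistic `X_(j)`, `1 ≤ j ≤ n` (the value outside this range is irrelevant). -/
def orderStat {n : ℕ} (X : Fin n → ℝ) (j : ℕ) : ℝ :=
  if h : j - 1 < n then X (Tuple.sort X ⟨j - 1, h⟩) else 0

/-! ### The design points and the system of index pairs -/

/-- `s_n = ⌈log₂ log n⌉`. -/
def sN (n : ℕ) : ℕ := ⌈Real.logb 2 (Real.log n)⌉₊

/-- The number `m = ⌊(n - 1) / 2 ^ s_n⌋ + 1` of design points. -/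
def numPts (n : ℕ) : ℕ := (n - 1) / 2 ^ sN n + 1

/-- The design points `x_i = X_(1 + (i - 1) 2 ^ s_n)`, `i = 1, …, m`. -/
def designPt {n : ℕ} (X : Fin n → ℝ) (i : ℕ) : ℝ := orderStat X (1 + (i - 1) * 2 ^ sN n)

/-- `B_max = ⌊log₂ (n / 8)⌋ - s_n`; a negative value means that there is no block. -/
def Bmax (n : ℕ) : ℤ := ⌊Real.logb 2 ((n : ℝ) / 8)⌋ - (sN n : ℤ)

/-- `n_B = ⌊(n - 1) / 2 ^ (B + s_n)⌋`. The `B`-th block of index pairs consists of the pairs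
`(1 + (i - 1) 2 ^ B, 1 + i 2 ^ B)`, `i = 1, …, n_B`. -/
def numBlock (n B : ℕ) : ℕ := (n - 1) / 2 ^ (B + sN n)

/-- `t_n = ∑_{B = 0}^{B_max} 1 / (B + 2)`. -/
def tN (n : ℕ) : ℝ := ∑ B ∈ Finset.range (Bmax n + 1).toNat, 1 / ((B : ℝ) + 2)

/-- The `p`-quantile of the beta distribution with parameters `r` and `s`. -/
def qBeta (p r s : ℝ) : ℝ :=
  sInf {t : ℝ | ENNReal.ofReal p ≤ ProbabilityTheory.betaMeasure r s (Iic t)}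

/-- The level `α / (2 (B + 2) n_B t_n)` of the weighted Bonferroni adjustment. -/
def levelB (n : ℕ) (α : ℝ) (B : ℕ) : ℝ :=
  α / (2 * ((B : ℝ) + 2) * (numBlock n B : ℝ) * tN n)

/-- The lower bound `c_B`. -/
def cB (n : ℕ) (α : ℝ) (B : ℕ) : ℝ :=
  qBeta (levelB n α B) ((2 : ℝ) ^ (B + sN n)) ((n : ℝ) + 1 - (2 : ℝ) ^ (B + sN n))

/-- The upper bound `d_B`. -/
def dB (n : ℕ) (α : ℝ) (B : ℕ) : ℝ :=
  qBeta (1 - levelB n α B) ((2 : ℝ) ^ (B + sN n)) ((n : ℝ) + 1 - (2 : ℝ) ^ (B + sN n))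

/-! ### The finite-dimensional constraint set -/

/-- `E(s) = ∫₀¹ exp (s t) dt`. -/
def bandE (s : ℝ) : ℝ := ∫ t in (0 : ℝ)..1, Real.exp (s * t)

/-- `L_i`. -/
def bandL (x l : ℕ → ℝ) (i : ℕ) : ℝ :=
  (x (i + 1) - x i) * Real.exp (l i) * bandE (l (i + 1) - l i)

/-- The integral over `[x_i, x_{i+1}]` of the exponential of the tangent at `x_i`. -/
def tangentLeft (x l g : ℕ → ℝ) (i : ℕ) : ℝ :=
  Real.exp (l i) * (x (i + 1) - x i) * bandE (g i * (x (i + 1) - x i))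

/-- The integral over `[x_i, x_{i+1}]` of the exponential of the tangent at `x_{i+1}`. -/
def tangentRight (x l g : ℕ → ℝ) (i : ℕ) : ℝ :=
  Real.exp (l (i + 1)) * (x (i + 1) - x i) * bandE (g (i + 1) * (x i - x (i + 1)))

/-- `U_i`. -/
def bandU (m : ℕ) (x l g : ℕ → ℝ) (i : ℕ) : ℝ :=
  if i = m - 1 then tangentLeft x l g i else tangentRight x l g i

/-- `V_i`. -/
def bandV (x l g : ℕ → ℝ) (i : ℕ) : ℝ :=
  if i = 1 then tangentRight x l g i else tangentLeft x l g i

/-- `(ℓ_1, …, ℓ_m)` and `(g_1, …, g_{m-1})` satisfy the constraints determined by the sample `X`. The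
vectors are indexed from `1`; their entries at all other indices are irrelevant. -/
structure IsFeasible {n : ℕ} (α : ℝ) (X : Fin n → ℝ) (l g : ℕ → ℝ) : Prop where
  conc : ∀ i ∈ Finset.Icc 2 (numPts n - 1), ∀ j ∈ ({i - 1, i + 1} : Finset ℕ),
    l j ≤ l i + g i * (designPt X j - designPt X i)
  down₁ : ∀ B : ℕ, (B : ℤ) ≤ Bmax n → ∀ i ∈ Finset.Icc 1 (numBlock n B),
    cB n α B ≤ ∑ r ∈ Finset.Ico (1 + (i - 1) * 2 ^ B) (1 + i * 2 ^ B),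
      bandU (numPts n) (designPt X) l g r
  down₂ : ∀ B : ℕ, (B : ℤ) ≤ Bmax n → ∀ i ∈ Finset.Icc 1 (numBlock n B),
    cB n α B ≤ ∑ r ∈ Finset.Ico (1 + (i - 1) * 2 ^ B) (1 + i * 2 ^ B),
      bandV (designPt X) l g r
  up : ∀ B : ℕ, (B : ℤ) ≤ Bmax n → ∀ i ∈ Finset.Icc 1 (numBlock n B),
    ∑ r ∈ Finset.Ico (1 + (i - 1) * 2 ^ B) (1 + i * 2 ^ B),
      bandL (designPt X) l r ≤ dB n α B

/-- The constraint set is non-empty, so that the confidence band is defined. -/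
def HasFeasible {n : ℕ} (α : ℝ) (X : Fin n → ℝ) : Prop :=
  ∃ l g : ℕ → ℝ, IsFeasible α X l g

/-- The lower bound for `log f (x_i)`: the minimum of `ℓ_i` over the constraint set. -/
def logLowerPt {n : ℕ} (α : ℝ) (X : Fin n → ℝ) (i : ℕ) : EReal :=
  ⨅ (l : ℕ → ℝ) (g : ℕ → ℝ) (_ : IsFeasible α X l g), (l i : EReal)

/-- The upper bound for `log f (x_i)`: the maximum of `ℓ_i` over the constraint set. -/
def logUpperPt {n : ℕ} (α : ℝ) (X : Fin n → ℝ) (i : ℕ) : EReal :=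
  ⨆ (l : ℕ → ℝ) (g : ℕ → ℝ) (_ : IsFeasible α X l g), (l i : EReal)

/-! ### The confidence band -/

/-- The number `i` of design points `≤ t`, so that `t ∈ [x_i, x_{i+1})`, with `x_0 = -∞` and
`x_{m+1} = ∞`. -/
def cell {n : ℕ} (X : Fin n → ℝ) (t : ℝ) : ℕ :=
  ((Finset.Icc 1 (numPts n)).filter fun i => designPt X i ≤ t).card

/-- The logarithm of the lower band: linear interpolation, and `-∞` outside `[x_1, x_m)`. -/
def logLower {n : ℕ} (α : ℝ) (X : Fin n → ℝ) (t : ℝ) : EReal :=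
  let x := designPt X
  let i := cell X t
  if 1 ≤ i ∧ i < numPts n then
    logLowerPt α X i + ((t - x i : ℝ) : EReal) *
      ((logLowerPt α X (i + 1) - logLowerPt α X i) / ((x (i + 1) - x i : ℝ) : EReal))
  else ⊥

/-- The slope `L_k`, bounding the slope of `log f` to the right of `x_k`. -/
def slopeL {n : ℕ} (α : ℝ) (X : Fin n → ℝ) (k : ℕ) : EReal :=
  ⨅ j ∈ Finset.Icc 1 (k - 1),
    (logUpperPt α X k - logLowerPt α X j) / ((designPt X k - designPt X j : ℝ) : EReal)

/-- The slope `R_k`, bounding the slope of `log f` to the left of `x_k`. -/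
def slopeR {n : ℕ} (α : ℝ) (X : Fin n → ℝ) (k : ℕ) : EReal :=
  ⨆ j ∈ Finset.Icc (k + 1) (numPts n),
    (logLowerPt α X j - logUpperPt α X k) / ((designPt X j - designPt X k : ℝ) : EReal)

/-- The line through `(x_k, μ(x_k))` with slope `L_k`. -/
def lineL {n : ℕ} (α : ℝ) (X : Fin n → ℝ) (k : ℕ) (t : ℝ) : EReal :=
  logUpperPt α X k + slopeL α X k * ((t - designPt X k : ℝ) : EReal)

/-- The line through `(x_k, μ(x_k))` with slope `R_k`. -/
def lineR {n : ℕ} (α : ℝ) (X : Fin n → ℝ) (k : ℕ) (t : ℝ) : EReal :=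
  logUpperPt α X k + slopeR α X k * ((t - designPt X k : ℝ) : EReal)

/-- The logarithm of the upper band: on `(x_i, x_{i+1})` with `i ∈ {0, 1}` the line from the right, on
`[x_i, x_{i+1})` with `2 ≤ i ≤ m - 2` the minimum of the two lines, and on `[x_i, x_{i+1})` with
`i ∈ {m - 1, m}` the line from the left. -/
def logUpper {n : ℕ} (α : ℝ) (X : Fin n → ℝ) (t : ℝ) : EReal :=
  let i := cell X t
  if t = designPt X 1 then logUpperPt α X 1
  else if i ≤ 1 then lineR α X (i + 1) t
  else if i + 2 ≤ numPts n then min (lineL α X i t) (lineR α X (i + 1) t)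
  else lineL α X i t

/-- The lower confidence bound for the density at `t`, with values in `[0, ∞]`. -/
def lowerBand {n : ℕ} (α : ℝ) (X : Fin n → ℝ) (t : ℝ) : EReal := (EReal.exp (logLower α X t) : EReal)

/-- The upper confidence bound for the density at `t`, with values in `[0, ∞]`. -/
def upperBand {n : ℕ} (α : ℝ) (X : Fin n → ℝ) (t : ℝ) : EReal := (EReal.exp (logUpper α X t) : EReal)

/-- The rate `√(log log n / n)`. -/
def rateN (n : ℕ) : ℝ := Real.sqrt (Real.log (Real.log n) / n)

end

/-! Around `[u, v]` choose `[u', v'] ⊆ J`, larger on both sides, on which `f` equals `exp (a + b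
t)`. Since `log f` is affine there, blocks of fixed length cause no bias, and the constraints of one
coarse level suffice: `subLevel K n`, which is `B_max - K` with `K` fixed.

Probability: at this level the nominal block mass `2 ^ (B + s_n) / n` lies between `2 ^ (-K) / 16`
and `2 ^ (-K) / 8`, and the number of blocks is bounded. Chebyshev's inequality at boundedly many
order statistics therefore keeps all block masses within `2 * rateN n` of nominal, failing with
probability `O(1 / log log n)` (`sampleLaw_orderStat_le`, `tendsto_badSamples`). The Bonferroni
level is at least a constant times `α / (log n)²`, so a Chernoff bound for beta laws puts `cB` and
`dB` within a multiple of `rateN n` of the nominal mass (`eventually_quantile`). The value of `α`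
affects only how large `n` must be, not the constant.

Determinism: on such samples every feasible `(l, g)` has tangent masses at least the true block mass
minus `κ`, and interpolant masses at most the true block mass plus `κ`, with `κ = O(rateN n)`. If `g
k ≥ b`, the tangents to the left of node `k` lie below the line of slope `b` through `(x k, l k)`,
so a small `l k` would violate the lower constraint on a block to the left; if `g k ≤ b`, a block to
the right does the same (`affine_sub_le`). If `l k` were large, concavity and the lower bounds at
the ends of its block would place a tent of too much mass under `l` (`le_affine_add`). Hence `l k =
a + b x_k + O(κ)` uniformly over feasible points. The lower band interpolates such values. The upper
band lies above the interpolant of any feasible point and below a line whose slope is controlled by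
a node a whole block away (`logUpper_mem`). Exponentiating gives the claim. -/

/-! ### Concave sequences with supergradients -/

/-- The data of a sequence `l` over strictly increasing nodes `x 1 < ⋯ < x m` with local
supergradients `g` at the inner nodes. -/
structure ConcaveNodes (m : ℕ) (x l g : ℕ → ℝ) : Prop where
  lt : ∀ i j, 1 ≤ i → i < j → j ≤ m → x i < x j
  conc : ∀ i ∈ Finset.Icc 2 (m - 1), ∀ j ∈ ({i - 1, i + 1} : Finset ℕ),
    l j ≤ l i + g i * (x j - x i)

namespace ConcaveNodes

variable {m : ℕ} {x l g : ℕ → ℝ}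

lemma le (h : ConcaveNodes m x l g) {i j : ℕ} (hi : 1 ≤ i) (hij : i ≤ j) (hj : j ≤ m) :
    x i ≤ x j := by
  rcases hij.eq_or_lt with rfl | hij
  · exact le_rfl
  · exact (h.lt i j hi hij hj).le

lemma le_succ (h : ConcaveNodes m x l g) {i : ℕ} (hi : 2 ≤ i) (him : i + 1 ≤ m) :
    l (i + 1) ≤ l i + g i * (x (i + 1) - x i) :=
  h.conc i (Finset.mem_Icc.2 ⟨hi, by omega⟩) (i + 1) (by simp)

lemma le_pred (h : ConcaveNodes m x l g) {i : ℕ} (hi : 1 ≤ i) (him : i + 2 ≤ m) :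
    l i ≤ l (i + 1) + g (i + 1) * (x i - x (i + 1)) :=
  h.conc (i + 1) (Finset.mem_Icc.2 ⟨by omega, by omega⟩) i (by simp)

/-- Adding the two inequalities that neighbouring nodes impose on each other cancels the values of
`l` and leaves the slopes. -/
lemma slope_succ_le (h : ConcaveNodes m x l g) {i : ℕ} (hi : 2 ≤ i) (him : i + 2 ≤ m) :
    g (i + 1) ≤ g i := by
  have h1 := h.le_succ hi (by omega)
  have h2 := h.le_pred (i := i) (by omega) him
  have h3 := h.lt i (i + 1) (by omega) (by omega) (by omega)
  have : (g (i + 1) - g i) * (x (i + 1) - x i) ≤ 0 := by nlinarith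
  by_contra hcon
  push Not at hcon
  nlinarith [mul_pos (sub_pos.2 hcon) (sub_pos.2 h3)]

lemma slope_antitone (h : ConcaveNodes m x l g) {i j : ℕ} (hi : 2 ≤ i) (hij : i ≤ j)
    (hj : j + 1 ≤ m) : g j ≤ g i := by
  induction j, hij using Nat.le_induction with
  | base => exact le_rfl
  | succ j hij ih => exact (h.slope_succ_le (by omega) (by omega)).trans (ih (by omega))

lemma le_tangent_right (h : ConcaveNodes m x l g) {i j : ℕ} (hi : 2 ≤ i)
    (hij : i ≤ j) (hj : j ≤ m) : l j ≤ l i + g i * (x j - x i) := by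
  induction j, hij using Nat.le_induction with
  | base => simp
  | succ j hij ih =>
    have h1 := ih (by omega)
    have h2 := h.le_succ (i := j) (by omega) (by omega)
    have h3 := h.slope_antitone hi hij (by omega)
    have h4 := h.lt j (j + 1) (by omega) (by omega) (by omega)
    nlinarith [mul_nonneg (sub_nonneg.2 h3) (sub_nonneg.2 h4.le)]

lemma le_tangent_left (h : ConcaveNodes m x l g) {i j : ℕ} (hj : 1 ≤ j) (hji : j ≤ i)
    (him : i + 1 ≤ m) : l j ≤ l i + g i * (x j - x i) := by
  induction hk : i - j generalizing j with
  | zero => obtain rfl : i = j := by omega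
            simp
  | succ k ih =>
    have h1 := ih (j := j + 1) (by omega) (by omega) (by omega)
    have h2 := h.le_pred (i := j) (by omega) (by omega)
    have h3 := h.slope_antitone (i := j + 1) (j := i) (by omega) (by omega) (by omega)
    have h4 := h.lt j (j + 1) (by omega) (by omega) (by omega)
    nlinarith [mul_nonneg (sub_nonneg.2 h3) (sub_nonneg.2 h4.le)]

/-- The constraints compare neighbours only. Monotonicity of the slopes makes each local
supergradient a global one. -/
lemma le_tangent (h : ConcaveNodes m x l g) {i j : ℕ} (hi : 2 ≤ i) (him : i + 1 ≤ m)
    (hj : 1 ≤ j) (hjm : j ≤ m) : l j ≤ l i + g i * (x j - x i) := by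
  rcases le_total i j with hij | hij
  · exact h.le_tangent_right hi hij hjm
  · exact h.le_tangent_left hj hij him

/-- The three-chord inequality. -/
lemma chord (h : ConcaveNodes m x l g) {p r k : ℕ} (hp : 1 ≤ p) (hpr : p ≤ r) (hrk : r ≤ k)
    (hk : k ≤ m) : l p * (x k - x r) + l k * (x r - x p) ≤ l r * (x k - x p) := by
  rcases hpr.eq_or_lt with rfl | hpr
  · nlinarith
  rcases hrk.eq_or_lt with rfl | hrk
  · nlinarith
  have h1 := h.le_tangent (i := r) (j := p) (by omega) (by omega) hp (by omega)
  have h2 := h.le_tangent (i := r) (j := k) (by omega) (by omega) (by omega) hk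
  have h3 := h.lt p r (by omega) (by omega) (by omega)
  have h4 := h.lt r k (by omega) (by omega) (by omega)
  nlinarith [mul_le_mul_of_nonneg_right h1 (sub_nonneg.2 h4.le),
    mul_le_mul_of_nonneg_right h2 (sub_nonneg.2 h3.le)]

end ConcaveNodes

/-! ### Integrals of exponentials of affine functions -/

/-- This is the substitution `t ↦ p + (q - p) t`. No order between `p` and `q` is assumed, so it
also covers the tangent at the right endpoint, where the interval is traversed backwards. -/
lemma mul_bandE_eq_integral (A S p q : ℝ) :
    (q - p) * Real.exp A * bandE (S * (q - p)) = ∫ t in p..q, Real.exp (A + S * (t - p)) := by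
  have h := intervalIntegral.smul_integral_comp_add_mul (a := 0) (b := 1)
    (fun t => Real.exp (A + S * (t - p))) (q - p) p
  simp only [mul_zero, add_zero, mul_one, add_sub_cancel, smul_eq_mul] at h
  rw [← h, bandE, mul_assoc, ← intervalIntegral.integral_const_mul]
  congr 1
  refine intervalIntegral.integral_congr fun t _ => ?_
  simp only [← Real.exp_add]
  ring_nf

lemma tangentLeft_eq_integral (x l g : ℕ → ℝ) (i : ℕ) :
    tangentLeft x l g i = ∫ t in x i..x (i + 1), Real.exp (l i + g i * (t - x i)) := by
  rw [← mul_bandE_eq_integral, tangentLeft]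
  ring

lemma tangentRight_eq_integral (x l g : ℕ → ℝ) (i : ℕ) :
    tangentRight x l g i =
      ∫ t in x i..x (i + 1), Real.exp (l (i + 1) + g (i + 1) * (t - x (i + 1))) := by
  rw [intervalIntegral.integral_symm, ← mul_bandE_eq_integral, tangentRight]
  ring

lemma bandL_eq_integral {x : ℕ → ℝ} (l : ℕ → ℝ) {i : ℕ} (h : x i < x (i + 1)) :
    bandL x l i = ∫ t in x i..x (i + 1),
      Real.exp (l i + (l (i + 1) - l i) / (x (i + 1) - x i) * (t - x i)) := by
  rw [← mul_bandE_eq_integral, bandL, div_mul_cancel₀ _ (sub_pos.2 h).ne']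

lemma sum_integral_exp_affine (x : ℕ → ℝ) (A S : ℝ) {p q : ℕ} (hpq : p ≤ q) :
    ∑ r ∈ Finset.Ico p q, ∫ t in x r..x (r + 1), Real.exp (A + S * t) =
      ∫ t in x p..x q, Real.exp (A + S * t) :=
  intervalIntegral.sum_integral_adjacent_intervals_Ico hpq fun _ _ =>
    (by fun_prop : Continuous fun t : ℝ => Real.exp (A + S * t)).intervalIntegrable _ _

lemma integral_exp_mono {p q : ℝ} (hpq : p ≤ q) {A S A' S' : ℝ}
    (h : ∀ t ∈ Icc p q, A + S * t ≤ A' + S' * t) :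
    ∫ t in p..q, Real.exp (A + S * t) ≤ ∫ t in p..q, Real.exp (A' + S' * t) :=
  intervalIntegral.integral_mono_on hpq
    ((by fun_prop : Continuous fun t : ℝ => Real.exp (A + S * t)).intervalIntegrable _ _)
    ((by fun_prop : Continuous fun t : ℝ => Real.exp (A' + S' * t)).intervalIntegrable _ _)
    fun t ht => Real.exp_le_exp.2 (h t ht)

lemma exp_mul_integral (A S B p q : ℝ) :
    ∫ t in p..q, Real.exp (A + B + S * t) = Real.exp A * ∫ t in p..q, Real.exp (B + S * t) := by
  rw [← intervalIntegral.integral_const_mul]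
  refine intervalIntegral.integral_congr fun t _ => ?_
  simp only [← Real.exp_add]
  ring_nf

/-! ### Block sums compared with integrals of exponentials of a single affine function. -/

namespace ConcaveNodes

variable {m : ℕ} {x l g : ℕ → ℝ}

/-- To the left of node `k` every tangent has slope at least `g k ≥ b`. Each tangent touches at the
right end of its cell, at a height below the line of slope `b` through `(x k, l k)`, and falls away
from that line towards the left. -/
lemma sum_bandU_le (h : ConcaveNodes m x l g) {k p q : ℕ} (hp : 1 ≤ p) (hpq : p ≤ q) (hq : q ≤ k)
    (hk : 2 ≤ k) (hkm : k + 1 ≤ m) {b : ℝ} (hb : b ≤ g k) :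
    ∑ r ∈ Finset.Ico p q, bandU m x l g r ≤
      ∫ t in x p..x q, Real.exp (l k - b * x k + b * t) := by
  rw [← sum_integral_exp_affine x _ _ hpq]
  refine Finset.sum_le_sum fun r hr => ?_
  rw [Finset.mem_Ico] at hr
  rw [bandU, if_neg (by omega), tangentRight_eq_integral]
  have e : ∀ t, l (r + 1) + g (r + 1) * (t - x (r + 1)) =
      (l (r + 1) - g (r + 1) * x (r + 1)) + g (r + 1) * t := fun t => by ring
  simp only [e]
  refine integral_exp_mono (h.lt r (r + 1) (by omega) (by omega) (by omega)).le fun t ht => ?_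
  have h1 := h.le_tangent (i := k) (j := r + 1) hk hkm (by omega) (by omega)
  have h2 := h.slope_antitone (i := r + 1) (j := k) (by omega) (by omega) hkm
  have h3 := h.le (i := r + 1) (j := k) (by omega) (by omega) (by omega)
  nlinarith [mul_nonneg (sub_nonneg.2 (hb.trans h2)) (sub_nonneg.2 ht.2),
    mul_nonneg (sub_nonneg.2 hb) (sub_nonneg.2 h3)]

/-- Mirror image of `sum_bandU_le`: to the right of node `k` the tangents touch at left ends and
have slopes at most `g k ≤ b`. -/
lemma sum_bandV_le (h : ConcaveNodes m x l g) {k p q : ℕ} (hpq : p ≤ q) (hp : k ≤ p)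
    (hq : q ≤ m) (hk : 2 ≤ k) (hkm : k + 1 ≤ m) {b : ℝ} (hb : g k ≤ b) :
    ∑ r ∈ Finset.Ico p q, bandV x l g r ≤
      ∫ t in x p..x q, Real.exp (l k - b * x k + b * t) := by
  rw [← sum_integral_exp_affine x _ _ hpq]
  refine Finset.sum_le_sum fun r hr => ?_
  rw [Finset.mem_Ico] at hr
  rw [bandV, if_neg (by omega), tangentLeft_eq_integral]
  have e : ∀ t, l r + g r * (t - x r) = (l r - g r * x r) + g r * t := fun t => by ring
  simp only [e]
  refine integral_exp_mono (h.lt r (r + 1) (by omega) (by omega) (by omega)).le fun t ht => ?_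
  have h1 := h.le_tangent (i := k) (j := r) hk hkm (by omega) (by omega)
  have h2 := h.slope_antitone (i := k) (j := r) (by omega) (by omega) (by omega)
  have h3 := h.le (i := k) (j := r) (by omega) (by omega) (by omega)
  nlinarith [mul_nonneg (sub_nonneg.2 (h2.trans hb)) (sub_nonneg.2 ht.1),
    mul_nonneg (sub_nonneg.2 hb) (sub_nonneg.2 h3)]

/-- The sum is the mass under the exponential of the piecewise linear interpolant of `l`, and an
affine function below `l` at the nodes is below the interpolant. -/
lemma integral_le_sum_bandL (h : ConcaveNodes m x l g) {p q : ℕ} (hp : 1 ≤ p) (hpq : p ≤ q)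
    (hq : q ≤ m) {A S : ℝ} (hA : ∀ r, p ≤ r → r ≤ q → A + S * x r ≤ l r) :
    ∫ t in x p..x q, Real.exp (A + S * t) ≤ ∑ r ∈ Finset.Ico p q, bandL x l r := by
  rw [← sum_integral_exp_affine x _ _ hpq]
  refine Finset.sum_le_sum fun r hr => ?_
  rw [Finset.mem_Ico] at hr
  have hlt := h.lt r (r + 1) (by omega) (by omega) (by omega)
  rw [bandL_eq_integral l hlt]
  set T := (l (r + 1) - l r) / (x (r + 1) - x r) with hT
  have e : ∀ t, l r + T * (t - x r) = (l r - T * x r) + T * t := fun t => by ring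
  simp only [e]
  refine integral_exp_mono hlt.le fun t ht => ?_
  have h1 := hA r (by omega) (by omega)
  have h2 := hA (r + 1) (by omega) (by omega)
  have h3 : T * (x (r + 1) - x r) = l (r + 1) - l r := div_mul_cancel₀ _ (sub_pos.2 hlt).ne'
  have h4 : (A + S * t) * (x (r + 1) - x r) ≤ (l r - T * x r + T * t) * (x (r + 1) - x r) := by
    have e1 : (A + S * t) * (x (r + 1) - x r) =
        (A + S * x r) * (x (r + 1) - t) + (A + S * x (r + 1)) * (t - x r) := by ring
    have e2 : (l r - T * x r + T * t) * (x (r + 1) - x r) =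
        l r * (x (r + 1) - t) + l (r + 1) * (t - x r) := by
      linear_combination (t - x r) * h3
    rw [e1, e2]
    exact add_le_add (mul_le_mul_of_nonneg_right h1 (sub_nonneg.2 ht.2))
      (mul_le_mul_of_nonneg_right h2 (sub_nonneg.2 ht.1))
  exact le_of_mul_le_mul_right h4 (sub_pos.2 hlt)

end ConcaveNodes

/-! ### Bounds for `l` at a node from the masses of blocks. -/

namespace ConcaveNodes

variable {m : ℕ} {x l g : ℕ → ℝ}

/-- In effect `z ≥ log (1 - κ / M)`, made linear in `κ`. It is applied with `z` the vertical
distance at a node between `l` and the true line. -/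
lemma log_lower_of_mass {M κ ρ z : ℝ} (hρ : 0 < ρ) (hκ : 0 ≤ κ) (hκρ : 2 * κ ≤ ρ) (hM : ρ ≤ M)
    (h : M - κ ≤ Real.exp z * M) : -(2 * κ / ρ) ≤ z := by
  by_contra hcon
  push Not at hcon
  have hw0 : 0 ≤ κ / ρ := by positivity
  have hw1 : κ / ρ ≤ 1 / 2 := by rw [div_le_iff₀ hρ]; linarith
  have hw : 2 * κ / ρ = 2 * (κ / ρ) := by ring
  have hκw : κ = κ / ρ * ρ := (div_mul_cancel₀ _ hρ.ne').symm
  set w := κ / ρ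
  rw [hw] at hcon
  -- The numerical fact is `(1 - w) (1 + 2 w) ≥ 1` for `0 ≤ w ≤ 1 / 2`.
  have h1 : Real.exp z < 1 - w := by
    have h2 : Real.exp z < Real.exp (-(2 * w)) := Real.exp_lt_exp.2 hcon
    have h3 : Real.exp (-(2 * w)) * Real.exp (2 * w) = 1 := by rw [← Real.exp_add]; simp
    have h4 : 2 * w + 1 ≤ Real.exp (2 * w) := Real.add_one_le_exp _
    have h5 := Real.exp_pos (-(2 * w))
    nlinarith [mul_le_mul_of_nonneg_left h4 h5.le]
  nlinarith [mul_lt_mul_of_pos_right h1 (hρ.trans_le hM)]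

/-- Near a block on either side with large mass under the tangents, `l` cannot be small. -/
lemma affine_sub_le (h : ConcaveNodes m x l g) {k p q p' q' : ℕ} (hp : 1 ≤ p) (hpq : p ≤ q)
    (hq : q ≤ k) (hk : 2 ≤ k) (hkm : k + 1 ≤ m) (hp' : k ≤ p') (hpq' : p' ≤ q') (hq' : q' ≤ m)
    {a b ρ κ : ℝ} (hρ : 0 < ρ) (hκ : 0 ≤ κ) (hκρ : 2 * κ ≤ ρ)
    (hM : ρ ≤ ∫ t in x p..x q, Real.exp (a + b * t))
    (hM' : ρ ≤ ∫ t in x p'..x q', Real.exp (a + b * t))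
    (hU : (∫ t in x p..x q, Real.exp (a + b * t)) - κ ≤ ∑ r ∈ Finset.Ico p q, bandU m x l g r)
    (hV : (∫ t in x p'..x q', Real.exp (a + b * t)) - κ ≤ ∑ r ∈ Finset.Ico p' q', bandV x l g r) :
    a + b * x k - 2 * κ / ρ ≤ l k := by
  -- The line of slope `b` through `(x k, l k)` is a vertical translate of `a + b t`, so the two
  -- masses differ by an exponential factor.
  have e : l k - b * x k = (l k - b * x k - a) + a := by ring
  have key : -(2 * κ / ρ) ≤ l k - b * x k - a := by
    -- A slope of at least `b` makes the left block informative, a slope of at most `b` the right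
    -- one.
    rcases le_total b (g k) with hb | hb
    · have h1 := hU.trans (h.sum_bandU_le hp hpq hq hk hkm hb)
      rw [e, exp_mul_integral] at h1
      exact log_lower_of_mass hρ hκ hκρ hM h1
    · have h1 := hV.trans (h.sum_bandV_le hpq' hp' hq' hk hkm hb)
      rw [e, exp_mul_integral] at h1
      exact log_lower_of_mass hρ hκ hκρ hM' h1
  linarith

/-- Apply `exp s ≥ 1 + s` to the perturbation `s = -ε + w₀ + w₁ t`. The nonnegative affine part
integrates to its midpoint value times the length. -/
lemma integral_exp_affine_add_ge {a b ε w₀ w₁ m₀ p q : ℝ} (hpq : p ≤ q)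
    (hm : ∀ t ∈ Icc p q, m₀ ≤ Real.exp (a + b * t)) (hw : ∀ t ∈ Icc p q, 0 ≤ w₀ + w₁ * t) :
    (1 - ε) * (∫ t in p..q, Real.exp (a + b * t)) + m₀ * ((w₀ + w₁ * ((p + q) / 2)) * (q - p)) ≤
      ∫ t in p..q, Real.exp ((a - ε + w₀) + (b + w₁) * t) := by
  have hc : Continuous fun t : ℝ => Real.exp (a + b * t) := by fun_prop
  have e : ∫ t in p..q, (w₀ + w₁ * t) = (w₀ + w₁ * ((p + q) / 2)) * (q - p) := by
    rw [intervalIntegral.integral_add (by simp)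
      ((by fun_prop : Continuous fun t : ℝ => w₁ * t).intervalIntegrable _ _),
      intervalIntegral.integral_const_mul, integral_id]
    simp only [intervalIntegral.integral_const, smul_eq_mul]
    ring
  rw [← e, ← intervalIntegral.integral_const_mul, ← intervalIntegral.integral_const_mul,
    ← intervalIntegral.integral_add ((hc.const_mul _).intervalIntegrable _ _)
      ((by fun_prop : Continuous fun t : ℝ => m₀ * (w₀ + w₁ * t)).intervalIntegrable _ _)]
  refine intervalIntegral.integral_mono_on hpq
    (((hc.const_mul _).add (by fun_prop)).intervalIntegrable _ _)
    ((by fun_prop : Continuous fun t : ℝ =>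
      Real.exp ((a - ε + w₀) + (b + w₁) * t)).intervalIntegrable _ _) fun t ht => ?_
  have h1 : Real.exp ((a - ε + w₀) + (b + w₁) * t) =
      Real.exp (a + b * t) * Real.exp (-ε + (w₀ + w₁ * t)) := by
    rw [← Real.exp_add]; ring_nf
  rw [h1]
  have h2 := Real.add_one_le_exp (-ε + (w₀ + w₁ * t))
  have h3 := Real.exp_pos (a + b * t)
  nlinarith [mul_le_mul_of_nonneg_left h2 h3.le, mul_le_mul_of_nonneg_right (hm t ht) (hw t ht)]

/-- By concavity `l` lies above the chord from `x p` to `x k`, hence above the true line lowered by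
`ε` plus a ramp rising from `0` to `D`. The ramp has mean `D / 2`. -/
lemma half_tent_left (h : ConcaveNodes m x l g) {p k : ℕ} (hp : 1 ≤ p) (hpk : p ≤ k) (hk : k ≤ m)
    {a b ε D m₀ : ℝ} (hD : 0 ≤ D) (hm : ∀ t ∈ Icc (x p) (x k), m₀ ≤ Real.exp (a + b * t))
    (hlp : a + b * x p - ε ≤ l p) (hlk : a + b * x k - ε + D ≤ l k) :
    (1 - ε) * (∫ t in x p..x k, Real.exp (a + b * t)) + m₀ * (D / 2 * (x k - x p)) ≤
      ∑ r ∈ Finset.Ico p k, bandL x l r := by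
  rcases hpk.eq_or_lt with rfl | hpk
  · simp
  have hlt := h.lt p k hp hpk hk
  have hd := sub_pos.2 hlt
  set w := D / (x k - x p) with hw
  have hwd : w * (x k - x p) = D := div_mul_cancel₀ _ hd.ne'
  have hw0 : 0 ≤ w := by positivity
  have h1 := integral_exp_affine_add_ge (ε := ε) (w₀ := -(w * x p)) (w₁ := w) hlt.le hm
    fun t ht => by nlinarith [mul_nonneg hw0 (sub_nonneg.2 ht.1)]
  have e : -(w * x p) + w * ((x p + x k) / 2) = D / 2 := by rw [← hwd]; ring
  rw [e] at h1
  refine h1.trans (h.integral_le_sum_bandL hp hpk.le hk fun r hpr hrk => ?_)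
  have h2 := h.chord hp hpr hrk hk
  have hr1 := sub_nonneg.2 (h.le hp hpr (hrk.trans hk))
  have hr2 := sub_nonneg.2 (h.le (hp.trans hpr) hrk hk)
  refine le_of_mul_le_mul_right ?_ hd
  have h3 := mul_le_mul_of_nonneg_right hlp hr2
  have h4 := mul_le_mul_of_nonneg_right hlk hr1
  have e2 : (a - ε + -(w * x p) + (b + w) * x r) * (x k - x p) =
      (a + b * x p - ε) * (x k - x r) + (a + b * x k - ε + D) * (x r - x p) := by
    rw [← hwd]; ring
  linarith

lemma half_tent_right (h : ConcaveNodes m x l g) {k q : ℕ} (hk : 1 ≤ k) (hkq : k ≤ q) (hq : q ≤ m)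
    {a b ε D m₀ : ℝ} (hD : 0 ≤ D) (hm : ∀ t ∈ Icc (x k) (x q), m₀ ≤ Real.exp (a + b * t))
    (hlq : a + b * x q - ε ≤ l q) (hlk : a + b * x k - ε + D ≤ l k) :
    (1 - ε) * (∫ t in x k..x q, Real.exp (a + b * t)) + m₀ * (D / 2 * (x q - x k)) ≤
      ∑ r ∈ Finset.Ico k q, bandL x l r := by
  rcases hkq.eq_or_lt with rfl | hkq
  · simp
  have hlt := h.lt k q hk hkq hq
  have hd := sub_pos.2 hlt
  set w := D / (x q - x k) with hw
  have hwd : w * (x q - x k) = D := div_mul_cancel₀ _ hd.ne'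
  have hw0 : 0 ≤ w := by positivity
  have h1 := integral_exp_affine_add_ge (ε := ε) (w₀ := w * x q) (w₁ := -w) hlt.le hm
    fun t ht => by nlinarith [mul_nonneg hw0 (sub_nonneg.2 ht.2)]
  have e : w * x q + -w * ((x k + x q) / 2) = D / 2 := by rw [← hwd]; ring
  rw [e] at h1
  refine h1.trans (h.integral_le_sum_bandL hk hkq.le hq fun r hkr hrq => ?_)
  have h2 := h.chord hk hkr hrq hq
  have hr1 := sub_nonneg.2 (h.le hk hkr (hrq.trans hq))
  have hr2 := sub_nonneg.2 (h.le (hk.trans hkr) hrq hq)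
  refine le_of_mul_le_mul_right ?_ hd
  have h3 := mul_le_mul_of_nonneg_right hlk hr2
  have h4 := mul_le_mul_of_nonneg_right hlq hr1
  have e2 : (a - ε + w * x q + (b + -w) * x r) * (x q - x k) =
      (a + b * x k - ε + D) * (x q - x r) + (a + b * x q - ε) * (x r - x k) := by
    rw [← hwd]; ring
  linarith

/-- Inside a block with small mass under `exp l`, a concave `l` cannot be large. -/
lemma le_affine_add (h : ConcaveNodes m x l g) {p k q : ℕ} (hp : 1 ≤ p) (hpk : p ≤ k)
    (hkq : k ≤ q) (hq : q ≤ m) {a b ρ κ ε m₀ M₀ : ℝ} (hρ : 0 < ρ) (hκ : 0 ≤ κ) (hε : 0 ≤ ε)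
    (hm₀ : 0 < m₀) (hm : ∀ t ∈ Icc (x p) (x q), m₀ ≤ Real.exp (a + b * t))
    (hM₀ : ∀ t ∈ Icc (x p) (x q), Real.exp (a + b * t) ≤ M₀)
    (hM : ρ ≤ ∫ t in x p..x q, Real.exp (a + b * t))
    (hM1 : ∫ t in x p..x q, Real.exp (a + b * t) ≤ 1)
    (hL : ∑ r ∈ Finset.Ico p q, bandL x l r ≤ (∫ t in x p..x q, Real.exp (a + b * t)) + κ)
    (hlp : a + b * x p - ε ≤ l p) (hlq : a + b * x q - ε ≤ l q) :
    l k ≤ a + b * x k + 2 * M₀ * (ε + κ) / (m₀ * ρ) := by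
  have hc : Continuous fun t : ℝ => Real.exp (a + b * t) := by fun_prop
  have hpq : x p ≤ x q := h.le hp (hpk.trans hkq) hq
  have hxk : x k ∈ Icc (x p) (x q) := ⟨h.le hp hpk (hkq.trans hq), h.le (hp.trans hpk) hkq hq⟩
  have hM₀' : 0 < M₀ := (Real.exp_pos _).trans_le (hM₀ _ ⟨le_rfl, hpq⟩)
  rcases le_total (l k) (a + b * x k - ε) with hlk | hlk
  · have : 0 ≤ 2 * M₀ * (ε + κ) / (m₀ * ρ) := by positivity
    linarith
  set D := l k - (a + b * x k - ε) with hDdef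
  have hD : 0 ≤ D := sub_nonneg.2 hlk
  have h1 := h.half_tent_left hp hpk (hkq.trans hq) hD
    (fun t ht => hm t ⟨ht.1, ht.2.trans hxk.2⟩) hlp (by linarith)
  have h2 := h.half_tent_right (hp.trans hpk) hkq hq hD
    (fun t ht => hm t ⟨hxk.1.trans ht.1, ht.2⟩) hlq (by linarith)
  have h3 := Finset.sum_Ico_consecutive (fun r => bandL x l r) hpk hkq
  have h4 := intervalIntegral.integral_add_adjacent_intervals (μ := volume)
    (hc.intervalIntegrable (x p) (x k)) (hc.intervalIntegrable (x k) (x q))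
  have h5 : ∫ t in x p..x q, Real.exp (a + b * t) ≤ M₀ * (x q - x p) := by
    have := intervalIntegral.integral_mono_on hpq (hc.intervalIntegrable (μ := volume) _ _)
      (intervalIntegrable_const (c := M₀)) hM₀
    simpa [mul_comm] using this
  -- The two ramps form a tent of height `D` over the whole block. Its extra mass must fit into the
  -- slack `κ` plus the loss `ε` times the mass.
  have h6 : (1 - ε) * (∫ t in x p..x q, Real.exp (a + b * t)) + m₀ * (D / 2 * (x q - x p)) ≤
      (∫ t in x p..x q, Real.exp (a + b * t)) + κ := by
    rw [← h4] at hL ⊢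
    nlinarith
  have h7 : m₀ * D * (x q - x p) ≤ 2 * (ε + κ) := by nlinarith [mul_le_mul_of_nonneg_left hM1 hε]
  have h8 : D * (m₀ * ρ) ≤ 2 * M₀ * (ε + κ) := by
    -- A block of mass at least `ρ` under a density at most `M₀` has length at least `ρ / M₀`.
    have h9 := mul_le_mul_of_nonneg_left (hM.trans h5) (mul_nonneg hm₀.le hD)
    have h10 := mul_le_mul_of_nonneg_left h7 hM₀'.le
    linarith
  have h11 : D ≤ 2 * M₀ * (ε + κ) / (m₀ * ρ) := by
    rw [le_div_iff₀ (by positivity)]; exact h8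
  linarith

end ConcaveNodes

/-! ### The band on samples with well-behaved blocks -/

/-- A sample for which the blocks `i₀, …, i₁ - 1` of level `B` lie in a range `[u', v']` around
`[u, v]` on which the density equals `exp (a + b t)`, have mass at least `ρ`, and have their mass
matched by `cB` and `dB` up to `κ`. -/
structure GoodSample {n : ℕ} (α : ℝ) (X : Fin n → ℝ) (a b u v u' v' ρ κ : ℝ) (B i₀ i₁ : ℕ) :
    Prop where
  lt : ∀ i j, 1 ≤ i → i < j → j ≤ numPts n → designPt X i < designPt X j
  level : (B : ℤ) ≤ Bmax n
  one_le : 1 ≤ i₀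
  lt_numBlock : i₁ + 1 ≤ numBlock n B
  add_le : i₀ + 5 ≤ i₁
  left_ge : u' ≤ designPt X (1 + i₀ * 2 ^ B)
  right_le : designPt X (1 + i₁ * 2 ^ B) ≤ v'
  le_left : designPt X (1 + (i₀ + 2) * 2 ^ B) ≤ u
  lt_right : v < designPt X (1 + (i₁ - 2) * 2 ^ B)
  mass_ge : ∀ i, i₀ ≤ i → i < i₁ → ρ ≤ ∫ t in designPt X (1 + i * 2 ^ B)..
    designPt X (1 + (i + 1) * 2 ^ B), Real.exp (a + b * t)
  mass_le : ∀ i, i₀ ≤ i → i < i₁ → ∫ t in designPt X (1 + i * 2 ^ B)..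
    designPt X (1 + (i + 1) * 2 ^ B), Real.exp (a + b * t) ≤ 1
  lower : ∀ i, i₀ ≤ i → i < i₁ → (∫ t in designPt X (1 + i * 2 ^ B)..
    designPt X (1 + (i + 1) * 2 ^ B), Real.exp (a + b * t)) - κ ≤ cB n α B
  upper : ∀ i, i₀ ≤ i → i < i₁ → dB n α B ≤ (∫ t in designPt X (1 + i * 2 ^ B)..
    designPt X (1 + (i + 1) * 2 ^ B), Real.exp (a + b * t)) + κ

/-- Block endpoints other than that of the last block stay strictly before the final node, so those
beyond the first node are inner nodes, where the supergradient constraints apply. -/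
lemma one_add_mul_lt_numPts {n B i : ℕ} (h : i + 1 ≤ numBlock n B) :
    1 + i * 2 ^ B + 1 ≤ numPts n := by
  have h1 : numBlock n B * 2 ^ B ≤ (n - 1) / 2 ^ sN n := by
    rw [numBlock, pow_add, mul_comm (2 ^ B), ← Nat.div_div_eq_div_mul]
    exact Nat.div_mul_le_self _ _
  have h2 := Nat.mul_le_mul_right (2 ^ B) h
  have h3 : 1 ≤ 2 ^ B := Nat.one_le_two_pow
  rw [numPts]
  rw [add_mul] at h2
  omega

/-- The constant in the bound for the logarithms at the design points. -/
noncomputable def nodeConst (m₀ M₀ ρ : ℝ) : ℝ := 2 / ρ + 2 * M₀ * (2 / ρ + 1) / (m₀ * ρ)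

lemma EReal.exists_coe_of_le_of_le {p q : ℝ} {z : EReal} (h1 : (p : EReal) ≤ z)
    (h2 : z ≤ (q : EReal)) : ∃ r : ℝ, z = r ∧ p ≤ r ∧ r ≤ q := by
  induction z with
  | bot => simp at h1
  | top => simp at h2
  | coe r => exact ⟨r, rfl, by exact_mod_cast h1, by exact_mod_cast h2⟩

lemma IsFeasible.logLowerPt_le {n : ℕ} {α : ℝ} {X : Fin n → ℝ} {l g : ℕ → ℝ}
    (h : IsFeasible α X l g) (i : ℕ) : logLowerPt α X i ≤ (l i : EReal) :=
  iInf_le_of_le l (iInf_le_of_le g (iInf_le_of_le h le_rfl))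

lemma IsFeasible.le_logUpperPt {n : ℕ} {α : ℝ} {X : Fin n → ℝ} {l g : ℕ → ℝ}
    (h : IsFeasible α X l g) (i : ℕ) : (l i : EReal) ≤ logUpperPt α X i :=
  le_iSup_of_le l (le_iSup_of_le g (le_iSup_of_le h le_rfl))

lemma cell_eq {n : ℕ} {X : Fin n → ℝ}
    (hlt : ∀ i j, 1 ≤ i → i < j → j ≤ numPts n → designPt X i < designPt X j) {t : ℝ} {i : ℕ}
    (hi : 1 ≤ i) (him : i + 1 ≤ numPts n) (h1 : designPt X i ≤ t) (h2 : t < designPt X (i + 1)) :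
    cell X t = i := by
  have : (Finset.Icc 1 (numPts n)).filter (fun i => designPt X i ≤ t) = Finset.Icc 1 i := by
    ext j
    simp only [Finset.mem_filter, Finset.mem_Icc]
    constructor
    · rintro ⟨⟨hj1, hj2⟩, hj3⟩
      refine ⟨hj1, ?_⟩
      by_contra hcon
      rcases (show i + 1 ≤ j by omega).eq_or_lt with rfl | hlt'
      · linarith
      · linarith [hlt (i + 1) j (by omega) hlt' hj2]
    · rintro ⟨hj1, hj2⟩
      refine ⟨⟨hj1, by omega⟩, ?_⟩
      rcases hj2.eq_or_lt with rfl | hlt'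
      · exact h1
      · linarith [hlt j i hj1 hlt' (by omega)]
  rw [cell, this]
  simp

/-! ### Feasible values at the nodes of a good sample. -/

namespace GoodSample

variable {n : ℕ} {α : ℝ} {X : Fin n → ℝ} {a b u v u' v' ρ κ : ℝ} {B i₀ i₁ : ℕ}

lemma concaveNodes (h : GoodSample α X a b u v u' v' ρ κ B i₀ i₁) {l g : ℕ → ℝ}
    (hf : IsFeasible α X l g) : ConcaveNodes (numPts n) (designPt X) l g :=
  ⟨h.lt, hf.conc⟩

lemma index_le (h : GoodSample α X a b u v u' v' ρ κ B i₀ i₁) {i : ℕ} (hi : i ≤ i₁) :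
    1 + i * 2 ^ B + 1 ≤ numPts n :=
  one_add_mul_lt_numPts (by have := h.lt_numBlock; omega)

lemma le (h : GoodSample α X a b u v u' v' ρ κ B i₀ i₁) {i j : ℕ} (hi : 1 ≤ i) (hij : i ≤ j)
    (hj : j ≤ numPts n) : designPt X i ≤ designPt X j := by
  rcases hij.eq_or_lt with rfl | hij
  · exact le_rfl
  · exact (h.lt i j hi hij hj).le

lemma one_add_mul_mono {i j : ℕ} (h : i ≤ j) : 1 + i * 2 ^ B ≤ 1 + j * 2 ^ B := by
  gcongr

/-- The two extreme blocks `i₀` and `i₁ - 1` serve as left and right block simultaneously for every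
node between them. -/
lemma node_ge (h : GoodSample α X a b u v u' v' ρ κ B i₀ i₁) {l g : ℕ → ℝ}
    (hf : IsFeasible α X l g) (hρ : 0 < ρ) (hκ : 0 ≤ κ) (hκρ : 2 * κ ≤ ρ) {k : ℕ}
    (hk : 1 + (i₀ + 1) * 2 ^ B ≤ k) (hk' : k ≤ 1 + (i₁ - 1) * 2 ^ B) :
    a + b * designPt X k - 2 * κ / ρ ≤ l k := by
  have hadd := h.add_le
  have hnum := h.lt_numBlock
  have e : i₁ - 1 + 1 = i₁ := by omega
  have hp : 1 ≤ 2 ^ B := Nat.one_le_two_pow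
  have h1 := h.mass_ge (i₁ - 1) (by omega) (by omega)
  -- The constraints count blocks from `1`, so index `i₀ + 1` is the block that starts at node `1 +
  -- i₀ * 2 ^ B`.
  have h2 := hf.down₁ B h.level (i₀ + 1) (Finset.mem_Icc.2 ⟨by omega, by omega⟩)
  have h3 := hf.down₂ B h.level i₁ (Finset.mem_Icc.2 ⟨by omega, by omega⟩)
  have h4 := h.lower (i₁ - 1) (by omega) (by omega)
  rw [e] at h1 h4
  simp only [add_tsub_cancel_right] at h2
  have h5 := h.index_le (i := i₁) le_rfl
  have h6 := one_add_mul_mono (B := B) (show i₀ ≤ i₀ + 1 by omega)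
  have h7 := one_add_mul_mono (B := B) (show i₁ - 1 ≤ i₁ by omega)
  have h8 : 2 ^ B ≤ (i₀ + 1) * 2 ^ B := Nat.le_mul_of_pos_left _ (by omega)
  exact (h.concaveNodes hf).affine_sub_le (by omega) h6 hk (by omega) (by omega) hk' h7 (by omega)
    hρ hκ hκρ (h.mass_ge i₀ le_rfl (by omega)) h1
    ((h.lower i₀ le_rfl (by omega)).trans h2) (h4.trans h3)

/-- The block containing node `k` has both endpoints in the range of `node_ge`, which supplies the
deficit `ε = 2 κ / ρ` for the tent argument. -/
lemma node_le (h : GoodSample α X a b u v u' v' ρ κ B i₀ i₁) {l g : ℕ → ℝ}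
    (hf : IsFeasible α X l g) (hρ : 0 < ρ) (hκ : 0 ≤ κ) (hκρ : 2 * κ ≤ ρ) {m₀ M₀ : ℝ}
    (hm₀ : 0 < m₀) (hm : ∀ t ∈ Icc u' v', m₀ ≤ Real.exp (a + b * t))
    (hM₀ : ∀ t ∈ Icc u' v', Real.exp (a + b * t) ≤ M₀) {k : ℕ}
    (hk : 1 + (i₀ + 1) * 2 ^ B ≤ k) (hk' : k < 1 + (i₁ - 1) * 2 ^ B) :
    l k ≤ a + b * designPt X k + 2 * M₀ * (2 * κ / ρ + κ) / (m₀ * ρ) := by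
  have hadd := h.add_le
  have hnum := h.lt_numBlock
  have hp : 0 < 2 ^ B := Nat.two_pow_pos B
  obtain ⟨i, hi⟩ : ∃ i, i = (k - 1) / 2 ^ B := ⟨_, rfl⟩
  have hi1 : i₀ + 1 ≤ i := by rw [hi, Nat.le_div_iff_mul_le hp]; omega
  have hi2 : i < i₁ - 1 := by rw [hi, Nat.div_lt_iff_lt_mul hp]; omega
  have hi3 : 1 + i * 2 ^ B ≤ k := by
    have := Nat.div_mul_le_self (k - 1) (2 ^ B)
    rw [← hi] at this
    omega
  have hi4 : k ≤ 1 + (i + 1) * 2 ^ B := by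
    have := Nat.lt_mul_of_div_lt (show (k - 1) / 2 ^ B < i + 1 by omega) hp
    omega
  have h2 := hf.up B h.level (i + 1) (Finset.mem_Icc.2 ⟨by omega, by omega⟩)
  simp only [add_tsub_cancel_right] at h2
  have h5 := h.index_le (i := i₁) le_rfl
  have h6 := one_add_mul_mono (B := B) (show i₀ ≤ i by omega)
  have h7 := one_add_mul_mono (B := B) (show i + 1 ≤ i₁ by omega)
  have h8 := one_add_mul_mono (B := B) (show i + 1 ≤ i₁ - 1 by omega)
  have h9 := one_add_mul_mono (B := B) (show i₀ + 1 ≤ i by omega)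
  have h10 := one_add_mul_mono (B := B) (show i ≤ i + 1 by omega)
  have hsub : Icc (designPt X (1 + i * 2 ^ B)) (designPt X (1 + (i + 1) * 2 ^ B)) ⊆ Icc u' v' :=
    Icc_subset_Icc (h.left_ge.trans (h.le (by omega) h6 (by omega)))
      ((h.le (by omega) h7 (by omega)).trans h.right_le)
  exact (h.concaveNodes hf).le_affine_add (by omega) hi3 hi4 (by omega) hρ hκ
    (by positivity) hm₀ (fun t ht => hm t (hsub ht)) (fun t ht => hM₀ t (hsub ht))
    (h.mass_ge i (by omega) (by omega)) (h.mass_le i (by omega) (by omega))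
    (h2.trans (h.upper i (by omega) (by omega)))
    (h.node_ge hf hρ hκ hκρ h9 (h10.trans h8)) (h.node_ge hf hρ hκ hκρ (h9.trans h10) h8)

lemma abs_node_le (h : GoodSample α X a b u v u' v' ρ κ B i₀ i₁) {l g : ℕ → ℝ}
    (hf : IsFeasible α X l g) (hρ : 0 < ρ) (hκ : 0 ≤ κ) (hκρ : 2 * κ ≤ ρ) {m₀ M₀ : ℝ}
    (hm₀ : 0 < m₀) (hM₀' : 0 < M₀) (hm : ∀ t ∈ Icc u' v', m₀ ≤ Real.exp (a + b * t))
    (hM₀ : ∀ t ∈ Icc u' v', Real.exp (a + b * t) ≤ M₀) {k : ℕ}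
    (hk : 1 + (i₀ + 1) * 2 ^ B ≤ k) (hk' : k < 1 + (i₁ - 1) * 2 ^ B) :
    a + b * designPt X k - nodeConst m₀ M₀ ρ * κ ≤ l k ∧
      l k ≤ a + b * designPt X k + nodeConst m₀ M₀ ρ * κ := by
  have h1 := h.node_ge hf hρ hκ hκρ hk hk'.le
  have h2 := h.node_le hf hρ hκ hκρ hm₀ hm hM₀ hk hk'
  have e : nodeConst m₀ M₀ ρ * κ = 2 * κ / ρ + 2 * M₀ * (2 * κ / ρ + κ) / (m₀ * ρ) := by
    rw [nodeConst]; ring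
  have h3 : 0 ≤ 2 * κ / ρ := by positivity
  have h4 : 0 ≤ 2 * M₀ * (2 * κ / ρ + κ) / (m₀ * ρ) := by positivity
  rw [e]
  constructor <;> linarith

lemma exists_cell (h : GoodSample α X a b u v u' v' ρ κ B i₀ i₁) {t : ℝ} (ht : t ∈ Icc u v) :
    ∃ i, cell X t = i ∧ 1 + (i₀ + 2) * 2 ^ B ≤ i ∧ i + 1 ≤ 1 + (i₁ - 2) * 2 ^ B ∧
      designPt X i ≤ t ∧ t < designPt X (i + 1) := by
  have hadd := h.add_le
  have h5 := h.index_le (i := i₁) le_rfl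
  have h6 := one_add_mul_mono (B := B) (show i₀ + 2 ≤ i₁ by omega)
  have h7 := one_add_mul_mono (B := B) (show i₁ - 2 ≤ i₁ by omega)
  have h8 : designPt X (1 + (i₀ + 2) * 2 ^ B) ≤ t := h.le_left.trans ht.1
  set i := Nat.findGreatest (fun i => designPt X i ≤ t) (numPts n) with hi
  have hi1 : 1 + (i₀ + 2) * 2 ^ B ≤ i := Nat.le_findGreatest (by omega) h8
  have hi2 : designPt X i ≤ t :=
    Nat.findGreatest_spec (P := fun i => designPt X i ≤ t) (by omega : _ ≤ numPts n) h8
  have hi3 : i ≤ numPts n := Nat.findGreatest_le _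
  have hi4 : i + 1 ≤ 1 + (i₁ - 2) * 2 ^ B := by
    by_contra hcon
    have := h.le (i := 1 + (i₁ - 2) * 2 ^ B) (j := i) (by omega) (by omega) hi3
    linarith [h.lt_right, ht.2]
  have hi5 : t < designPt X (i + 1) := by
    by_contra hcon
    push Not at hcon
    have := Nat.le_findGreatest (P := fun i => designPt X i ≤ t) (n := numPts n) (by omega) hcon
    omega
  exact ⟨i, cell_eq h.lt (by omega) (by omega) hi2 hi5, hi1, hi4, hi2, hi5⟩

end GoodSample

/-- The constant in the bound for the logarithm of the band. -/
noncomputable def bandConst (m₀ M₀ ρ u' v' : ℝ) : ℝ :=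
  nodeConst m₀ M₀ ρ * (1 + 2 * (v' - u') * M₀ / ρ)

lemma chord_slope_le {m : ℕ} {x l g : ℕ → ℝ} (h : ConcaveNodes m x l g) {p r k : ℕ} (hp : 1 ≤ p)
    (hpr : p < r) (hrk : r < k) (hk : k ≤ m) :
    (l k - l r) / (x k - x r) ≤ (l r - l p) / (x r - x p) := by
  have h1 := h.chord hp hpr.le hrk.le hk
  have h2 := h.lt p r hp hpr (by omega)
  have h3 := h.lt r k (by omega) hrk hk
  rw [div_le_div_iff₀ (sub_pos.2 h3) (sub_pos.2 h2)]
  nlinarith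

/-! ### The logarithm of the band between the nodes. -/

namespace GoodSample

variable {n : ℕ} {α : ℝ} {X : Fin n → ℝ} {a b u v u' v' ρ κ : ℝ} {B i₀ i₁ : ℕ}

/-- The bounds at the design points. -/
lemma exists_pt (h : GoodSample α X a b u v u' v' ρ κ B i₀ i₁) (hfe : HasFeasible α X)
    (hρ : 0 < ρ) (hκ : 0 ≤ κ) (hκρ : 2 * κ ≤ ρ) {m₀ M₀ : ℝ}
    (hm₀ : 0 < m₀) (hM₀' : 0 < M₀) (hm : ∀ t ∈ Icc u' v', m₀ ≤ Real.exp (a + b * t))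
    (hM₀ : ∀ t ∈ Icc u' v', Real.exp (a + b * t) ≤ M₀) {k : ℕ}
    (hk : 1 + (i₀ + 1) * 2 ^ B ≤ k) (hk' : k < 1 + (i₁ - 1) * 2 ^ B) :
    ∃ lo up : ℝ, logLowerPt α X k = lo ∧ logUpperPt α X k = up ∧
      a + b * designPt X k - nodeConst m₀ M₀ ρ * κ ≤ lo ∧ lo ≤ up ∧
      up ≤ a + b * designPt X k + nodeConst m₀ M₀ ρ * κ := by
  obtain ⟨l, g, hf⟩ := hfe
  have h1 : ((a + b * designPt X k - nodeConst m₀ M₀ ρ * κ : ℝ) : EReal) ≤ logLowerPt α X k :=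
    le_iInf fun l => le_iInf fun g => le_iInf fun hf => by
      exact_mod_cast (h.abs_node_le hf hρ hκ hκρ hm₀ hM₀' hm hM₀ hk hk').1
  have h2 : logUpperPt α X k ≤ ((a + b * designPt X k + nodeConst m₀ M₀ ρ * κ : ℝ) : EReal) :=
    iSup_le fun l => iSup_le fun g => iSup_le fun hf => by
      exact_mod_cast (h.abs_node_le hf hρ hκ hκρ hm₀ hM₀' hm hM₀ hk hk').2
  have h3 := (hf.logLowerPt_le k).trans (hf.le_logUpperPt k)
  obtain ⟨lo, hlo, h4, -⟩ := EReal.exists_coe_of_le_of_le h1 (h3.trans h2)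
  obtain ⟨up, hup, -, h5⟩ := EReal.exists_coe_of_le_of_le (h1.trans h3) h2
  refine ⟨lo, up, hlo, hup, h4, ?_, h5⟩
  rw [hlo, hup] at h3
  exact_mod_cast h3

lemma logLower_mem (h : GoodSample α X a b u v u' v' ρ κ B i₀ i₁) (hfe : HasFeasible α X)
    (hρ : 0 < ρ) (hκ : 0 ≤ κ) (hκρ : 2 * κ ≤ ρ) {m₀ M₀ : ℝ}
    (hm₀ : 0 < m₀) (hM₀' : 0 < M₀) (hm : ∀ t ∈ Icc u' v', m₀ ≤ Real.exp (a + b * t))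
    (hM₀ : ∀ t ∈ Icc u' v', Real.exp (a + b * t) ≤ M₀) {t : ℝ} (ht : t ∈ Icc u v) :
    ∃ z : ℝ, logLower α X t = z ∧ a + b * t - nodeConst m₀ M₀ ρ * κ ≤ z ∧
      z ≤ a + b * t + nodeConst m₀ M₀ ρ * κ := by
  have hadd := h.add_le
  obtain ⟨i, hi, hi1, hi2, hi3, hi4⟩ := h.exists_cell ht
  have h1 := one_add_mul_mono (B := B) (show i₀ + 1 ≤ i₀ + 2 by omega)
  have h2 : 1 + (i₁ - 2) * 2 ^ B < 1 + (i₁ - 1) * 2 ^ B :=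
    Nat.add_lt_add_left (Nat.mul_lt_mul_of_pos_right (by omega) (Nat.two_pow_pos B)) 1
  have h3 := one_add_mul_mono (B := B) (show i₁ - 1 ≤ i₁ by omega)
  have h4 := h.index_le (i := i₁) le_rfl
  obtain ⟨p, _, hp, _, hp1, hp2, hp3⟩ := h.exists_pt hfe hρ hκ hκρ hm₀ hM₀' hm hM₀ (k := i)
    (by omega) (by omega)
  obtain ⟨q, _, hq, _, hq1, hq2, hq3⟩ := h.exists_pt hfe hρ hκ hκρ hm₀ hM₀' hm hM₀ (k := i + 1)
    (by omega) (by omega)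
  set e := nodeConst m₀ M₀ ρ * κ
  have hd : 0 < designPt X (i + 1) - designPt X i := by linarith
  refine ⟨p + (t - designPt X i) * ((q - p) / (designPt X (i + 1) - designPt X i)), ?_, ?_, ?_⟩
  · rw [logLower]
    simp only [hi, hp, hq]
    rw [if_pos ⟨by omega, by omega⟩]
    norm_cast
  · refine le_of_mul_le_mul_right ?_ hd
    have e1 : (p + (t - designPt X i) * ((q - p) / (designPt X (i + 1) - designPt X i))) *
        (designPt X (i + 1) - designPt X i) =
        p * (designPt X (i + 1) - t) + q * (t - designPt X i) := by
      field_simp; ring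
    rw [e1]
    have := mul_le_mul_of_nonneg_right hp1 (sub_nonneg.2 hi4.le)
    have := mul_le_mul_of_nonneg_right hq1 (sub_nonneg.2 hi3)
    linarith
  · refine le_of_mul_le_mul_right ?_ hd
    have e1 : (p + (t - designPt X i) * ((q - p) / (designPt X (i + 1) - designPt X i))) *
        (designPt X (i + 1) - designPt X i) =
        p * (designPt X (i + 1) - t) + q * (t - designPt X i) := by
      field_simp; ring
    rw [e1]
    have := mul_le_mul_of_nonneg_right (hp2.trans hp3) (sub_nonneg.2 hi4.le)
    have := mul_le_mul_of_nonneg_right (hq2.trans hq3) (sub_nonneg.2 hi3)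
    linarith

/-- A feasible vector minorizes the lines of the upper band. -/
lemma interp_le_lineL (h : GoodSample α X a b u v u' v' ρ κ B i₀ i₁) {l g : ℕ → ℝ}
    (hf : IsFeasible α X l g) {i : ℕ} (him : i + 1 ≤ numPts n) {t : ℝ}
    (ht : designPt X i ≤ t) :
    ((l i + (l (i + 1) - l i) / (designPt X (i + 1) - designPt X i) * (t - designPt X i) : ℝ) :
      EReal) ≤ lineL α X i t := by
  rw [lineL, EReal.coe_add, EReal.coe_mul]
  refine add_le_add (hf.le_logUpperPt i)
    (mul_le_mul_of_nonneg_right ?_ (by exact_mod_cast sub_nonneg.2 ht))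
  refine le_iInf₂ fun j hj => ?_
  rw [Finset.mem_Icc] at hj
  have h1 := h.lt j i hj.1 (by omega) (by omega)
  have h2 := chord_slope_le (h.concaveNodes hf) hj.1 (by omega : j < i) (by omega : i < i + 1) him
  have h3 : (((l i - l j) / (designPt X i - designPt X j) : ℝ) : EReal) ≤
      (logUpperPt α X i - logLowerPt α X j) / ((designPt X i - designPt X j : ℝ) : EReal) := by
    rw [EReal.coe_div, EReal.coe_sub]
    exact EReal.div_le_div_right_of_nonneg (by exact_mod_cast (sub_pos.2 h1).le)
      (EReal.sub_le_sub (hf.le_logUpperPt i) (hf.logLowerPt_le j))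
  exact le_trans (by exact_mod_cast h2) h3

/-- Chords beyond `x (i + 1)` have slopes at most that of the cell; since `t` lies to the left of
that node, the smaller slope gives the higher line. -/
lemma interp_le_lineR (h : GoodSample α X a b u v u' v' ρ κ B i₀ i₁) {l g : ℕ → ℝ}
    (hf : IsFeasible α X l g) {i : ℕ} (hi : 1 ≤ i) {t : ℝ}
    (ht : t ≤ designPt X (i + 1)) :
    ((l (i + 1) + (l (i + 1) - l i) / (designPt X (i + 1) - designPt X i) *
      (t - designPt X (i + 1)) : ℝ) : EReal) ≤ lineR α X (i + 1) t := by
  rw [lineR, EReal.coe_add, EReal.coe_mul]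
  refine add_le_add (hf.le_logUpperPt (i + 1))
    (EReal.mul_le_mul_of_nonpos_right ?_ (by exact_mod_cast sub_nonpos.2 ht))
  refine iSup₂_le fun j hj => ?_
  rw [Finset.mem_Icc] at hj
  have h1 := h.lt (i + 1) j (by omega) (by omega) (by omega)
  have h2 := chord_slope_le (h.concaveNodes hf) hi (by omega : i < i + 1) (by omega : i + 1 < j)
    hj.2
  have h3 : (logLowerPt α X j - logUpperPt α X (i + 1)) /
      ((designPt X j - designPt X (i + 1) : ℝ) : EReal) ≤
      (((l j - l (i + 1)) / (designPt X j - designPt X (i + 1)) : ℝ) : EReal) := by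
    rw [EReal.coe_div, EReal.coe_sub]
    exact EReal.div_le_div_right_of_nonneg (by exact_mod_cast (sub_pos.2 h1).le)
      (EReal.sub_le_sub (hf.logLowerPt_le j) (hf.le_logUpperPt (i + 1)))
  exact h3.trans (by exact_mod_cast h2)

lemma logUpper_mem (h : GoodSample α X a b u v u' v' ρ κ B i₀ i₁) (hfe : HasFeasible α X)
    (hρ : 0 < ρ) (hκ : 0 ≤ κ) (hκρ : 2 * κ ≤ ρ) {m₀ M₀ : ℝ}
    (hm₀ : 0 < m₀) (hM₀' : 0 < M₀) (hm : ∀ t ∈ Icc u' v', m₀ ≤ Real.exp (a + b * t))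
    (hM₀ : ∀ t ∈ Icc u' v', Real.exp (a + b * t) ≤ M₀) {t : ℝ} (ht : t ∈ Icc u v) :
    ((a + b * t - nodeConst m₀ M₀ ρ * κ : ℝ) : EReal) ≤ logUpper α X t ∧
      logUpper α X t ≤ ((a + b * t + bandConst m₀ M₀ ρ u' v' * κ : ℝ) : EReal) := by
  have hadd := h.add_le
  obtain ⟨i, hi, hi1, hi2, hi3, hi4⟩ := h.exists_cell ht
  have hlt : ∀ {i j : ℕ}, i < j → 1 + i * 2 ^ B < 1 + j * 2 ^ B := fun hij =>
    Nat.add_lt_add_left (Nat.mul_lt_mul_of_pos_right hij (Nat.two_pow_pos B)) 1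
  have h1 := hlt (show i₀ + 1 < i₀ + 2 by omega)
  have h1' := hlt (show 0 < i₀ + 1 by omega)
  have h1'' := one_add_mul_mono (B := B) (show i₀ ≤ i₀ + 1 by omega)
  have h2 := hlt (show i₁ - 2 < i₁ - 1 by omega)
  have h3 := one_add_mul_mono (B := B) (show i₁ - 1 ≤ i₁ by omega)
  have h4 := h.index_le (i := i₁) le_rfl
  have hne : t ≠ designPt X 1 := by
    have := h.lt 1 i le_rfl (by omega) (by omega)
    linarith
  have hup : logUpper α X t = min (lineL α X i t) (lineR α X (i + 1) t) := by
    rw [logUpper]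
    simp only [hi]
    rw [if_neg hne, if_neg (by omega), if_pos (by omega)]
  rw [hup]
  constructor
  -- Any single feasible point suffices here: its interpolant is below both lines and close to the
  -- true line.
  · obtain ⟨l, g, hf⟩ := hfe
    have h5 := (h.abs_node_le hf hρ hκ hκρ hm₀ hM₀' hm hM₀ (k := i) (by omega) (by omega)).1
    have h6 := (h.abs_node_le hf hρ hκ hκρ hm₀ hM₀' hm hM₀ (k := i + 1) (by omega) (by omega)).1
    have h7 := h.interp_le_lineL hf (by omega) hi3
    have h8 := h.interp_le_lineR hf (by omega) hi4.le
    have hd : 0 < designPt X (i + 1) - designPt X i := by linarith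
    set T := (l (i + 1) - l i) / (designPt X (i + 1) - designPt X i) with hT
    have hTd : T * (designPt X (i + 1) - designPt X i) = l (i + 1) - l i :=
      div_mul_cancel₀ _ hd.ne'
    set e := nodeConst m₀ M₀ ρ * κ
    have h9 : a + b * t - e ≤ l i + T * (t - designPt X i) := by
      refine le_of_mul_le_mul_right ?_ hd
      have e1 : (l i + T * (t - designPt X i)) * (designPt X (i + 1) - designPt X i) =
          l i * (designPt X (i + 1) - t) + l (i + 1) * (t - designPt X i) := by
        linear_combination (t - designPt X i) * hTd
      rw [e1]
      have := mul_le_mul_of_nonneg_right h5 (sub_nonneg.2 hi4.le)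
      have := mul_le_mul_of_nonneg_right h6 (sub_nonneg.2 hi3)
      linarith
    refine le_min (le_trans (by exact_mod_cast h9) h7) (le_trans ?_ h8)
    have h10 : a + b * t - e ≤ l (i + 1) + T * (t - designPt X (i + 1)) := by linarith
    exact_mod_cast h10
  -- For the bound from above one of the two lines is enough.
  · refine (min_le_left _ _).trans ?_
    obtain ⟨_, p, _, hp, hp1, hp2, hp3⟩ := h.exists_pt hfe hρ hκ hκρ hm₀ hM₀' hm hM₀ (k := i)
      (by omega) (by omega)
    obtain ⟨q, _, hq, _, hq1, hq2, hq3⟩ := h.exists_pt hfe hρ hκ hκρ hm₀ hM₀' hm hM₀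
      (k := 1 + (i₀ + 1) * 2 ^ B) le_rfl (by have := hlt (show i₀ + 1 < i₁ - 1 by omega); omega)
    have hx1 : u' ≤ designPt X (1 + (i₀ + 1) * 2 ^ B) :=
      h.left_ge.trans (h.le (by omega) h1'' (by omega))
    have hx2 : designPt X (1 + (i₀ + 2) * 2 ^ B) ≤ v' :=
      (h.le (by omega) (by omega) (by omega)).trans h.right_le
    have hx3 : designPt X (1 + (i₀ + 2) * 2 ^ B) ≤ designPt X i :=
      h.le (by omega) hi1 (by omega)
    have hx4 := h.lt _ _ (by omega) h1 (by omega)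
    have hx5 : designPt X (i + 1) ≤ v' :=
      (h.le (by omega) (show i + 1 ≤ 1 + i₁ * 2 ^ B by omega) (by omega)).trans h.right_le
    have hmass := h.mass_ge (i₀ + 1) (by omega) (by omega)
    have hc : Continuous fun t : ℝ => Real.exp (a + b * t) := by fun_prop
    have hint : ρ ≤ M₀ * (designPt X (1 + (i₀ + 2) * 2 ^ B) -
        designPt X (1 + (i₀ + 1) * 2 ^ B)) := by
      have := intervalIntegral.integral_mono_on hx4.le (hc.intervalIntegrable (μ := volume) _ _)
        (intervalIntegrable_const (c := M₀))
        fun t ht => hM₀ t ⟨hx1.trans ht.1, ht.2.trans hx2⟩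
      rw [intervalIntegral.integral_const, smul_eq_mul] at this
      exact (hmass.trans this).trans_eq (mul_comm _ _)
    set e := nodeConst m₀ M₀ ρ * κ with he
    set y := designPt X (1 + (i₀ + 1) * 2 ^ B)
    have he0 : 0 ≤ e := by rw [he, nodeConst]; positivity
    have hd : 0 < designPt X i - y := by linarith
    -- The infimum is tested at the single node `y`, which a whole block separates from `x i`. A
    -- nearby node would magnify the error of the difference quotient.
    have hs : slopeL α X i ≤ (((p - q) / (designPt X i - y) : ℝ) : EReal) := by
      refine (iInf₂_le (1 + (i₀ + 1) * 2 ^ B)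
        (Finset.mem_Icc.2 ⟨by omega, by omega⟩)).trans ?_
      rw [hp, hq, EReal.coe_div, EReal.coe_sub p q]
    have h5 : lineL α X i t ≤
        ((p + (p - q) / (designPt X i - y) * (t - designPt X i) : ℝ) : EReal) := by
      rw [lineL, EReal.coe_add, EReal.coe_mul, hp]
      exact add_le_add le_rfl
        (mul_le_mul_of_nonneg_right hs (by exact_mod_cast sub_nonneg.2 hi3))
    refine h5.trans (EReal.coe_le_coe_iff.2 ?_)
    have h6 : (p - q) / (designPt X i - y) ≤ b + 2 * e * M₀ / ρ := by
      rw [div_le_iff₀ hd]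
      -- The endpoint errors `2 e` are spread over a distance of at least `ρ / M₀`, so the slope is
      -- off by at most `2 e M₀ / ρ`.
      have h7 : 2 * e ≤ 2 * e * M₀ / ρ * (designPt X i - y) := by
        rw [div_mul_eq_mul_div, le_div_iff₀ hρ, mul_assoc (2 * e)]
        refine mul_le_mul_of_nonneg_left ?_ (by positivity)
        exact hint.trans (mul_le_mul_of_nonneg_left (by linarith) hM₀'.le)
      linarith
    have h8 : 2 * e * M₀ / ρ * (t - designPt X i) ≤ 2 * e * M₀ / ρ * (v' - u') :=
      mul_le_mul_of_nonneg_left (by linarith) (by positivity)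
    have h9 := mul_le_mul_of_nonneg_right h6 (sub_nonneg.2 hi3)
    have e2 : bandConst m₀ M₀ ρ u' v' * κ = e + 2 * e * M₀ / ρ * (v' - u') := by
      rw [bandConst, he]; ring
    rw [e2]
    linarith

end GoodSample

/-! ### From the logarithm of the band to the band -/

lemma exists_coe_exp {z : EReal} {A E M : ℝ} (hE1 : E ≤ 1) (hM : Real.exp A ≤ M)
    (h1 : ((A - E : ℝ) : EReal) ≤ z) (h2 : z ≤ ((A + E : ℝ) : EReal)) :
    ∃ w : ℝ, ((EReal.exp z : ENNReal) : EReal) = w ∧ |w - Real.exp A| ≤ 2 * M * E := by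
  obtain ⟨r, rfl, hr1, hr2⟩ := EReal.exists_coe_of_le_of_le h1 h2
  refine ⟨Real.exp r, ?_, ?_⟩
  · rw [EReal.exp_coe, EReal.coe_ennreal_ofReal, max_eq_left (Real.exp_pos _).le]
  · have h3 : |Real.exp (r - A) - 1| ≤ 2 * |r - A| :=
      Real.abs_exp_sub_one_le (abs_le.2 ⟨by linarith, by linarith⟩)
    have h4 : |r - A| ≤ E := abs_le.2 ⟨by linarith, by linarith⟩
    have h5 : Real.exp r - Real.exp A = Real.exp A * (Real.exp (r - A) - 1) := by
      rw [mul_sub, ← Real.exp_add]; ring_nf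
    rw [h5, abs_mul, abs_of_pos (Real.exp_pos _)]
    have h6 := mul_le_mul hM (h3.trans (mul_le_mul_of_nonneg_left h4 zero_le_two))
      (abs_nonneg _) ((Real.exp_pos _).le.trans hM)
    linarith

lemma GoodSample.band {n : ℕ} {α : ℝ} {X : Fin n → ℝ} {a b u v u' v' ρ κ : ℝ} {B i₀ i₁ : ℕ}
    (h : GoodSample α X a b u v u' v' ρ κ B i₀ i₁) (hfe : HasFeasible α X)
    (hρ : 0 < ρ) (hκ : 0 ≤ κ) (hκρ : 2 * κ ≤ ρ) {m₀ M₀ : ℝ} (hu : u' ≤ u) (hv : v ≤ v')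
    (hm₀ : 0 < m₀) (hM₀' : 0 < M₀) (hm : ∀ t ∈ Icc u' v', m₀ ≤ Real.exp (a + b * t))
    (hM₀ : ∀ t ∈ Icc u' v', Real.exp (a + b * t) ≤ M₀) (hsmall : bandConst m₀ M₀ ρ u' v' * κ ≤ 1)
    {t : ℝ} (ht : t ∈ Icc u v) :
    ∃ lo up : ℝ, lowerBand α X t = lo ∧ upperBand α X t = up ∧
      |lo - Real.exp (a + b * t)| ≤ 2 * M₀ * (bandConst m₀ M₀ ρ u' v' * κ) ∧
      |up - Real.exp (a + b * t)| ≤ 2 * M₀ * (bandConst m₀ M₀ ρ u' v' * κ) := by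
  have htu : t ∈ Icc u' v' := ⟨hu.trans ht.1, ht.2.trans hv⟩
  have huv : 0 ≤ v' - u' := by linarith [htu.1, htu.2]
  have hn : 0 ≤ nodeConst m₀ M₀ ρ := by rw [nodeConst]; positivity
  have hle : nodeConst m₀ M₀ ρ * κ ≤ bandConst m₀ M₀ ρ u' v' * κ := by
    refine mul_le_mul_of_nonneg_right ?_ hκ
    rw [bandConst]
    refine le_mul_of_one_le_right hn ?_
    have : 0 ≤ 2 * (v' - u') * M₀ / ρ := by positivity
    linarith
  have h0 : 0 ≤ nodeConst m₀ M₀ ρ * κ := mul_nonneg hn hκ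
  set E := bandConst m₀ M₀ ρ u' v' * κ
  obtain ⟨z, hz, hz1, hz2⟩ := h.logLower_mem hfe hρ hκ hκρ hm₀ hM₀' hm hM₀ ht
  obtain ⟨hw1, hw2⟩ := h.logUpper_mem hfe hρ hκ hκρ hm₀ hM₀' hm hM₀ ht
  obtain ⟨lo, hlo, hlo'⟩ := exists_coe_exp (z := logLower α X t) hsmall
    (hM₀ t htu) (by rw [hz]; exact_mod_cast (by linarith)) (by rw [hz]; exact_mod_cast (by linarith))
  obtain ⟨up, hup, hup'⟩ := exists_coe_exp hsmall (hM₀ t htu)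
    (le_trans (by exact_mod_cast (by linarith)) hw1) hw2
  exact ⟨lo, up, hlo, hup, hlo', hup'⟩

/-! ### Tails and quantiles of beta distributions -/

section Beta

open ProbabilityTheory

lemma beta_comm (a b : ℝ) : beta a b = beta b a := by
  rw [beta, beta, mul_comm, add_comm]

lemma beta_add_one_left {a b : ℝ} (ha : 0 < a) (hb : 0 < b) :
    beta (a + 1) b = a / (a + b) * beta a b := by
  have h1 : a + 1 + b = a + b + 1 := by ring
  have h2 := (Real.Gamma_pos_of_pos (add_pos ha hb)).ne'
  have h3 := (add_pos ha hb).ne'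
  rw [beta, beta, h1, Real.Gamma_add_one ha.ne', Real.Gamma_add_one h3]
  field_simp

/-- The ratio of beta functions is the product of `(a + j) / (a + b + j)` over `j < k`. Each factor
is at most `a / (a + b)` times `exp (j / a)`, and the sum of the exponents is at most `k ^ 2 / (2
a)`. -/
lemma beta_add_nat_le {a b : ℝ} (ha : 0 < a) (hb : 0 < b) (k : ℕ) :
    beta (a + k) b ≤ (a / (a + b)) ^ k * Real.exp ((k : ℝ) ^ 2 / (2 * a)) * beta a b := by
  induction k with
  | zero => simp
  | succ k ih =>
    have hak : 0 < a + k := by positivity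
    have hB := beta_pos ha hb
    have h1 : (a + k) / (a + k + b) ≤ a / (a + b) * Real.exp (k / a) := by
      have h2 : (a + k) / (a + k + b) ≤ a / (a + b) * (k / a + 1) := by
        have : a / (a + b) * (k / a + 1) = (a + k) / (a + b) := by field_simp; ring
        rw [this]
        have hk : (0 : ℝ) ≤ k := k.cast_nonneg
        gcongr
        linarith
      exact h2.trans (mul_le_mul_of_nonneg_left (Real.add_one_le_exp _) (by positivity))
    have h3 : Real.exp (k / a) * Real.exp ((k : ℝ) ^ 2 / (2 * a)) ≤
        Real.exp (((k + 1 : ℕ) : ℝ) ^ 2 / (2 * a)) := by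
      rw [← Real.exp_add, Real.exp_le_exp]
      have : (k : ℝ) / a + (k : ℝ) ^ 2 / (2 * a) = (2 * k + (k : ℝ) ^ 2) / (2 * a) := by
        field_simp
      rw [this]
      push_cast
      gcongr
      nlinarith
    push_cast
    rw [← add_assoc, beta_add_one_left hak hb]
    calc (a + k) / (a + k + b) * beta (a + k) b
        ≤ (a / (a + b) * Real.exp (k / a)) *
          ((a / (a + b)) ^ k * Real.exp ((k : ℝ) ^ 2 / (2 * a)) * beta a b) :=
          mul_le_mul h1 ih (beta_pos hak hb).le (by positivity)
      _ = (a / (a + b)) ^ (k + 1) * (Real.exp (k / a) * Real.exp ((k : ℝ) ^ 2 / (2 * a))) *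
          beta a b := by ring
      _ ≤ (a / (a + b)) ^ (k + 1) * Real.exp (((k + 1 : ℕ) : ℝ) ^ 2 / (2 * a)) * beta a b := by
          gcongr
      _ = _ := by push_cast; ring

lemma lintegral_pow_betaMeasure {a b : ℝ} (ha : 0 < a) (hb : 0 < b) (k : ℕ) :
    ∫⁻ x, ENNReal.ofReal (x ^ k) ∂betaMeasure a b =
      ENNReal.ofReal (beta (a + k) b / beta a b) := by
  have hB := beta_pos ha hb
  have hak : 0 < a + k := by positivity
  have hB' := beta_pos hak hb
  rw [betaMeasure, lintegral_withDensity_eq_lintegral_mul _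
    (by unfold betaPDF; fun_prop) (by fun_prop)]
  have : ∀ x, (betaPDF a b * fun x => ENNReal.ofReal (x ^ k)) x =
      ENNReal.ofReal (beta (a + k) b / beta a b) * betaPDF (a + k) b x := by
    intro x
    simp only [Pi.mul_apply, betaPDF]
    by_cases hx : 0 < x ∧ x < 1
    · rw [← ENNReal.ofReal_mul (betaPDFReal_pos hx.1 hx.2 ha hb).le,
        ← ENNReal.ofReal_mul (by positivity), betaPDFReal, betaPDFReal, if_pos hx, if_pos hx]
      congr 1
      have e : x ^ (a + k - 1) = x ^ (a - 1) * x ^ k := by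
        rw [← Real.rpow_natCast, ← Real.rpow_add hx.1]
        ring_nf
      rw [e]
      field_simp
    · simp [betaPDFReal, hx]
  simp_rw [this]
  rw [lintegral_const_mul _ (by unfold betaPDF; fun_prop), lintegral_betaPDF_eq_one hak hb, mul_one]

/-- Moments of the reflected variable, needed for the lower tail. -/
lemma lintegral_one_sub_pow_betaMeasure {a b : ℝ} (ha : 0 < a) (hb : 0 < b) (k : ℕ) :
    ∫⁻ x, ENNReal.ofReal ((1 - x) ^ k) ∂betaMeasure a b =
      ENNReal.ofReal (beta (b + k) a / beta b a) := by
  have hB := beta_pos ha hb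
  have hbk : 0 < b + k := by positivity
  have hB' := beta_pos ha hbk
  rw [beta_comm (b + k) a, beta_comm b a, betaMeasure, lintegral_withDensity_eq_lintegral_mul _
    (by unfold betaPDF; fun_prop) (by fun_prop)]
  have : ∀ x, (betaPDF a b * fun x => ENNReal.ofReal ((1 - x) ^ k)) x =
      ENNReal.ofReal (beta a (b + k) / beta a b) * betaPDF a (b + k) x := by
    intro x
    simp only [Pi.mul_apply, betaPDF]
    by_cases hx : 0 < x ∧ x < 1
    · rw [← ENNReal.ofReal_mul (betaPDFReal_pos hx.1 hx.2 ha hb).le,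
        ← ENNReal.ofReal_mul (by positivity), betaPDFReal, betaPDFReal, if_pos hx, if_pos hx]
      congr 1
      have e : (1 - x) ^ (b + k - 1) = (1 - x) ^ (b - 1) * (1 - x) ^ k := by
        rw [← Real.rpow_natCast, ← Real.rpow_add (by linarith)]
        ring_nf
      rw [e]
      field_simp
    · simp [betaPDFReal, hx]
  simp_rw [this]
  rw [lintegral_const_mul _ (by unfold betaPDF; fun_prop), lintegral_betaPDF_eq_one ha hbk, mul_one]

lemma exp_half_le_one_add {ε : ℝ} (h0 : 0 ≤ ε) (h1 : ε ≤ 1) : Real.exp (ε / 2) ≤ 1 + ε := by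
  have h2 : 1 - ε / 2 ≤ Real.exp (-(ε / 2)) := Real.one_sub_le_exp_neg _
  have h3 : Real.exp (ε / 2) * Real.exp (-(ε / 2)) = 1 := by rw [← Real.exp_add]; simp
  have h4 := Real.exp_pos (ε / 2)
  nlinarith [mul_le_mul_of_nonneg_left h2 h4.le]

/-- The Chernoff bound obtained from a moment of the optimal order. -/
lemma exists_moment_bound {a b ε : ℝ} (ha : 0 < a) (hb : 0 < b) (h0 : 0 ≤ ε) (h1 : ε ≤ 1) :
    ∃ k : ℕ, beta (a + k) b / beta a b ≤
      Real.exp (1 / 4 - ε ^ 2 * a / 8) * (a / (a + b) * (1 + ε)) ^ k := by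
  -- The exponent `k ^ 2 / (2 a) - k ε / 2` is minimal at `k = ε a / 2`. Rounding down costs at most
  -- `ε / 4`, whence the `1 / 4`.
  obtain ⟨k, hk⟩ : ∃ k, k = ⌊ε * a / 2⌋₊ := ⟨_, rfl⟩
  have hk1 : (k : ℝ) ≤ ε * a / 2 := by rw [hk]; exact Nat.floor_le (by positivity)
  have hk2 : ε * a / 2 < k + 1 := by rw [hk]; exact Nat.lt_floor_add_one _
  refine ⟨k, ?_⟩
  rw [div_le_iff₀ (beta_pos ha hb)]
  refine (beta_add_nat_le ha hb k).trans ?_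
  rw [mul_pow, mul_left_comm]
  have hp : 0 ≤ (a / (a + b)) ^ k := by positivity
  refine mul_le_mul_of_nonneg_right (mul_le_mul_of_nonneg_left ?_ hp) (beta_pos ha hb).le
  have h2 : Real.exp (ε / 2) ^ k ≤ (1 + ε) ^ k :=
    pow_le_pow_left₀ (Real.exp_pos _).le (exp_half_le_one_add h0 h1) k
  refine le_trans ?_ (mul_le_mul_of_nonneg_left h2 (Real.exp_pos _).le)
  rw [← Real.exp_nat_mul, ← Real.exp_add, Real.exp_le_exp]
  have h3 : (k : ℝ) ^ 2 / (2 * a) ≤ k * ε / 4 := by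
    rw [div_le_iff₀ (by positivity)]
    nlinarith [mul_le_mul_of_nonneg_left hk1 (Nat.cast_nonneg (α := ℝ) k)]
  nlinarith [mul_le_mul_of_nonneg_left hk2.le h0]

lemma betaMeasure_Ici_le {a b ε : ℝ} (ha : 0 < a) (hb : 0 < b) (h0 : 0 ≤ ε) (h1 : ε ≤ 1) :
    betaMeasure a b (Ici (a / (a + b) * (1 + ε))) ≤
      ENNReal.ofReal (Real.exp (1 / 4 - ε ^ 2 * a / 8)) := by
  obtain ⟨k, hk⟩ := exists_moment_bound ha hb h0 h1
  set t := a / (a + b) * (1 + ε) with ht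
  have ht0 : 0 < t := by positivity
  have htk : 0 < t ^ k := by positivity
  have h2 := mul_meas_ge_le_lintegral₀ (μ := betaMeasure a b)
    (f := fun x => ENNReal.ofReal (x ^ k)) (by fun_prop) (ENNReal.ofReal (t ^ k))
  rw [lintegral_pow_betaMeasure ha hb] at h2
  have h3 : Ici t ⊆ {x | ENNReal.ofReal (t ^ k) ≤ ENNReal.ofReal (x ^ k)} := fun x hx =>
    ENNReal.ofReal_le_ofReal (pow_le_pow_left₀ ht0.le hx k)
  have h4 := (mul_le_mul_right (measure_mono h3) _).trans (h2.trans (ENNReal.ofReal_le_ofReal hk))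
  rw [ENNReal.ofReal_mul (Real.exp_pos _).le, mul_comm] at h4
  exact (ENNReal.mul_le_mul_iff_left (by simpa using htk) ENNReal.ofReal_ne_top).1 h4

/-- Markov's inequality for powers of `1 - x`, whose law is beta with the parameters exchanged. The
deviation is therefore relative to the mean of `1 - x`. -/
lemma betaMeasure_Iic_le {a b ε : ℝ} (ha : 0 < a) (hb : 0 < b) (h0 : 0 ≤ ε) (h1 : ε ≤ 1) :
    betaMeasure a b (Iic (1 - b / (b + a) * (1 + ε))) ≤
      ENNReal.ofReal (Real.exp (1 / 4 - ε ^ 2 * b / 8)) := by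
  obtain ⟨k, hk⟩ := exists_moment_bound hb ha h0 h1
  set t := b / (b + a) * (1 + ε) with ht
  have ht0 : 0 < t := by positivity
  have htk : 0 < t ^ k := by positivity
  have h2 := mul_meas_ge_le_lintegral₀ (μ := betaMeasure a b)
    (f := fun x => ENNReal.ofReal ((1 - x) ^ k)) (by fun_prop) (ENNReal.ofReal (t ^ k))
  rw [lintegral_one_sub_pow_betaMeasure ha hb] at h2
  have h3 : Iic (1 - t) ⊆ {x | ENNReal.ofReal (t ^ k) ≤ ENNReal.ofReal ((1 - x) ^ k)} :=
    fun x hx => ENNReal.ofReal_le_ofReal (pow_le_pow_left₀ ht0.le (by linarith [mem_Iic.1 hx]) k)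
  have h4 := (mul_le_mul_right (measure_mono h3) _).trans (h2.trans (ENNReal.ofReal_le_ofReal hk))
  rw [ENNReal.ofReal_mul (Real.exp_pos _).le, mul_comm] at h4
  exact (ENNReal.mul_le_mul_iff_left (by simpa using htk) ENNReal.ofReal_ne_top).1 h4

lemma betaMeasure_Iic_of_nonpos {a b t : ℝ} (ht : t ≤ 0) : betaMeasure a b (Iic t) = 0 := by
  rw [betaMeasure, withDensity_apply _ measurableSet_Iic]
  exact setLIntegral_eq_zero measurableSet_Iic fun x hx =>
    betaPDF_eq_zero_of_nonpos (le_trans hx ht)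

lemma qBeta_le {a b ε δ : ℝ} (ha : 0 < a) (hb : 0 < b) (h0 : 0 ≤ ε) (h1 : ε ≤ 1) (hδ : δ < 1)
    (h : Real.exp (1 / 4 - ε ^ 2 * a / 8) ≤ δ) : qBeta (1 - δ) a b ≤ a / (a + b) * (1 + ε) := by
  have := isProbabilityMeasureBeta ha hb
  -- A level `1 - δ > 0` is not reached at negative points, so the set defining the quantile is
  -- bounded below.
  refine csInf_le ⟨0, fun t ht => ?_⟩ ?_
  · by_contra hcon
    push Not at hcon
    rw [mem_ofPred_eq, betaMeasure_Iic_of_nonpos hcon.le, nonpos_iff_eq_zero,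
      ENNReal.ofReal_eq_zero] at ht
    linarith
  · set t := a / (a + b) * (1 + ε)
    have h2 : betaMeasure a b (Ioi t) ≤ ENNReal.ofReal δ :=
      (measure_mono Ioi_subset_Ici_self).trans
        ((betaMeasure_Ici_le ha hb h0 h1).trans (ENNReal.ofReal_le_ofReal h))
    have h3 : betaMeasure a b (Iic t) = 1 - betaMeasure a b (Ioi t) := by
      rw [← compl_Ioi, prob_compl_eq_one_sub measurableSet_Ioi]
    have hδ0 : 0 ≤ δ := (Real.exp_pos _).le.trans h
    rw [mem_ofPred_eq, h3, ENNReal.ofReal_sub _ hδ0, ENNReal.ofReal_one]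
    exact tsub_le_tsub_left h2 _

lemma le_qBeta {a b ε δ : ℝ} (ha : 0 < a) (hb : 0 < b) (h0 : 0 ≤ ε) (h1 : ε ≤ 1) (hδ : δ < 1)
    (h : Real.exp (1 / 4 - ε ^ 2 * b / 8) < δ) : 1 - b / (b + a) * (1 + ε) ≤ qBeta δ a b := by
  have := isProbabilityMeasureBeta ha hb
  -- Nonemptiness matters because `sInf ∅ = 0`; the point `1` carries the full mass to its left.
  refine le_csInf ⟨1, ?_⟩ fun t ht => ?_
  · have h3 : betaMeasure a b (Ioi 1) = 0 := by
      rw [betaMeasure, withDensity_apply _ measurableSet_Ioi]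
      exact setLIntegral_eq_zero measurableSet_Ioi fun x hx =>
        betaPDF_eq_zero_of_one_le (le_of_lt hx)
    rw [mem_ofPred_eq, ← compl_Ioi, prob_compl_eq_one_sub measurableSet_Ioi, h3, tsub_zero]
    exact ENNReal.ofReal_le_one.2 hδ.le
  · by_contra hcon
    push Not at hcon
    have h2 := (measure_mono (Iic_subset_Iic.2 hcon.le)).trans (betaMeasure_Iic_le ha hb h0 h1)
    have h3 := le_trans ht h2
    rw [ENNReal.ofReal_le_ofReal_iff (Real.exp_pos _).le] at h3
    linarith

end Beta

/-! ### Counts and order statistics -/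

section Sample

open ProbabilityTheory

/-- Chebyshev's inequality, with variance at most `1 / 4` for an indicator. -/
lemma pi_count_deviation_le {ν : Measure ℝ} [IsProbabilityMeasure ν] (n : ℕ) {s : Set ℝ}
    [DecidablePred (· ∈ s)] (hs : MeasurableSet s) {c : ℝ} (hc : 0 < c) :
    Measure.pi (fun _ : Fin n => ν)
      {X | c ≤ |((Finset.univ.filter fun i => X i ∈ s).card : ℝ) - n * ν.real s|} ≤
      ENNReal.ofReal (n / (4 * c ^ 2)) := by
  set Y : ℝ → ℝ := s.indicator fun _ => 1 with hY
  have hYm : Measurable Y := measurable_const.indicator hs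
  have hYb : ∀ᵐ x ∂ν, Y x ∈ Icc (0 : ℝ) 1 := ae_of_all _ fun x => by
    by_cases hx : x ∈ s <;> simp [hY, hx]
  have hY2 : MemLp Y 2 ν := memLp_of_bounded hYb hYm.aestronglyMeasurable 2
  have hvar := variance_sum_pi (ι := Fin n) (μ := fun _ => ν) (X := fun _ => Y) fun _ => hY2
  have hvar1 : Var[Y; ν] ≤ 1 / 4 := (variance_le_sq_of_bounded hYb hYm.aemeasurable).trans
    (by norm_num)
  have hmp : ∀ i : Fin n, MemLp (fun X : Fin n → ℝ => Y (X i)) 2 (Measure.pi fun _ => ν) :=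
    fun i => hY2.comp_measurePreserving (measurePreserving_eval _ i)
  have hL : MemLp (∑ i, fun X : Fin n → ℝ => Y (X i)) 2 (Measure.pi fun _ => ν) :=
    memLp_finsetSum' _ fun i _ => hmp i
  have hmean : (Measure.pi fun _ : Fin n => ν)[∑ i, fun X : Fin n → ℝ => Y (X i)] =
      n * ν.real s := by
    simp only [Finset.sum_apply]
    rw [integral_finsetSum _ fun i _ => (hmp i).integrable (by norm_num)]
    have : ∀ i : Fin n, ∫ X, Y (X i) ∂(Measure.pi fun _ : Fin n => ν) = ν.real s := by
      intro i
      rw [integral_comp_eval (μ := fun _ : Fin n => ν) (i := i) (f := Y)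
        hYm.aestronglyMeasurable, hY, integral_indicator_const _ hs]
      simp
    simp [this]
  have hcheb := meas_ge_le_variance_div_sq hL hc
  rw [hmean, hvar] at hcheb
  refine le_trans (measure_mono fun X hX => ?_) (hcheb.trans (ENNReal.ofReal_le_ofReal ?_))
  · have e : (∑ i, fun X : Fin n → ℝ => Y (X i)) X =
        ((Finset.univ.filter fun i => X i ∈ s).card : ℝ) := by
      simp [hY, indicator_apply, Finset.sum_apply]
    simpa only [mem_ofPred_eq, e] using hX
  · simp only [Finset.sum_const, Finset.card_univ, Fintype.card_fin, nsmul_eq_mul]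
    rw [← div_div]
    gcongr
    linarith [mul_le_mul_of_nonneg_left hvar1 (Nat.cast_nonneg (α := ℝ) n)]

lemma orderStat_le_iff {n : ℕ} (X : Fin n → ℝ) {j : ℕ} (hj : 1 ≤ j) (hjn : j ≤ n) (t : ℝ) :
    orderStat X j ≤ t ↔ j ≤ (Finset.univ.filter fun i => X i ≤ t).card := by
  have h : j - 1 < n := by omega
  rw [orderStat, dif_pos h]
  have h1 := Tuple.lt_card_le_iff_apply_le_of_monotone (a := t) (j := ⟨j - 1, h⟩)
    (Tuple.monotone_sort X)
  simp only [Function.comp_apply] at h1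
  rw [← h1]
  have h2 : (Finset.univ.filter fun i => X (Tuple.sort X i) ≤ t).card =
      (Finset.univ.filter fun i => X i ≤ t).card :=
    Finset.card_equiv (Tuple.sort X) (by simp)
  rw [h2]
  omega

lemma orderStat_lt {n : ℕ} {X : Fin n → ℝ} (hX : Function.Injective X) {i j : ℕ} (hi : 1 ≤ i)
    (hij : i < j) (hj : j ≤ n) : orderStat X i < orderStat X j := by
  have h1 : i - 1 < n := by omega
  have h2 : j - 1 < n := by omega
  rw [orderStat, orderStat, dif_pos h1, dif_pos h2]
  exact ((Tuple.monotone_sort X).strictMono_of_injective (hX.comp (Tuple.sort X).injective))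
    (Fin.mk_lt_mk.2 (by omega))

lemma designPt_lt {n : ℕ} {X : Fin n → ℝ} (hX : Function.Injective X) (i j : ℕ) (hi : 1 ≤ i)
    (hij : i < j) (hj : j ≤ numPts n) : designPt X i < designPt X j := by
  rw [numPts] at hj
  have h1 : (j - 1) * 2 ^ sN n ≤ n - 1 :=
    (Nat.mul_le_mul_right _ (by omega : j - 1 ≤ (n - 1) / 2 ^ sN n)).trans (Nat.div_mul_le_self _ _)
  have h2 : (i - 1) * 2 ^ sN n < (j - 1) * 2 ^ sN n :=
    Nat.mul_lt_mul_of_pos_right (by omega) (Nat.two_pow_pos _)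
  exact orderStat_lt hX (by omega) (by omega) (by omega)

/-- Two coordinates have the law `ν × ν`, which gives the diagonal no mass when `ν` has no atoms. -/
lemma pi_ae_injective {ν : Measure ℝ} [IsProbabilityMeasure ν] [NullSingletonClass ν] (n : ℕ) :
    ∀ᵐ X ∂Measure.pi (fun _ : Fin n => ν), Function.Injective X := by
  have h : ∀ i j : Fin n, i ≠ j → ∀ᵐ X ∂Measure.pi (fun _ : Fin n => ν), X i ≠ X j := by
    intro i j hij
    have h1 := (iIndepFun_pi (μ := fun _ : Fin n => ν) (X := fun _ => id)
      fun _ => aemeasurable_id).indepFun hij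
    simp only [id] at h1
    have h2 := (indepFun_iff_map_prod_eq_prod_map_map (measurable_pi_apply i).aemeasurable
      (measurable_pi_apply j).aemeasurable).1 h1
    have h3 : ∀ i : Fin n, (Measure.pi fun _ : Fin n => ν).map (fun X => X i) = ν :=
      fun i => (measurePreserving_eval (fun _ : Fin n => ν) i).map_eq
    rw [h3, h3] at h2
    have h4 : (ν.prod ν) (diagonal ℝ) = 0 := by
      rw [Measure.measure_prod_null measurableSet_diagonal]
      refine ae_of_all _ fun x => ?_
      have : Prod.mk x ⁻¹' diagonal ℝ = {x} := by ext y; simp [eq_comm]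
      simp only [this, measure_singleton, Pi.zero_apply]
    rw [← h2, Measure.map_apply (by fun_prop) measurableSet_diagonal] at h4
    rw [ae_iff]
    simpa [preimage, diagonal, id] using h4
  have h5 : ∀ᵐ X ∂Measure.pi (fun _ : Fin n => ν), ∀ i j : Fin n, i ≠ j → X i ≠ X j := by
    simp_rw [ae_all_iff]
    exact h
  filter_upwards [h5] with X hX i j hij
  by_contra hne
  exact hX i j hne hij

/-- The distribution function of the density `f`. -/
noncomputable def distFun (f : ℝ → ℝ) (t : ℝ) : ℝ := ∫ x in Iic t, f x

lemma distFun_sub {f : ℝ → ℝ} (hf : Integrable f) (p q : ℝ) :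
    distFun f q - distFun f p = ∫ x in p..q, f x :=
  intervalIntegral.integral_Iic_sub_Iic hf.integrableOn hf.integrableOn

lemma continuous_distFun {f : ℝ → ℝ} (hf : Integrable f) : Continuous (distFun f) := by
  have h : distFun f = fun t => distFun f 0 + ∫ x in (0 : ℝ)..t, f x := by
    ext t; rw [← distFun_sub hf]; ring
  rw [h]
  exact continuous_const.add
    (intervalIntegral.continuous_primitive (fun _ _ => hf.intervalIntegrable) 0)

/-! ### Concentration of the order statistics on the scale of the distribution function. -/

namespace IsLogConcaveDensity

variable {f : ℝ → ℝ}

lemma isProbabilityMeasure (hf : IsLogConcaveDensity f) :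
    IsProbabilityMeasure (volume.withDensity fun x => ENNReal.ofReal (f x)) := by
  constructor
  rw [withDensity_apply _ MeasurableSet.univ, Measure.restrict_univ,
    ← ofReal_integral_eq_lintegral_ofReal hf.integrable (ae_of_all _ hf.nonneg),
    hf.integral_eq_one, ENNReal.ofReal_one]

lemma withDensity_Iic (hf : IsLogConcaveDensity f) (t : ℝ) :
    (volume.withDensity fun x => ENNReal.ofReal (f x)).real (Iic t) = distFun f t := by
  rw [measureReal_def, withDensity_apply _ measurableSet_Iic,
    ← ofReal_integral_eq_lintegral_ofReal hf.integrable.integrableOn (ae_of_all _ hf.nonneg),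
    ENNReal.toReal_ofReal (integral_nonneg hf.nonneg), distFun]

lemma distFun_mono (hf : IsLogConcaveDensity f) : Monotone (distFun f) := fun _ _ hpq =>
  setIntegral_mono_set hf.integrable.integrableOn (ae_of_all _ hf.nonneg)
    (Iic_subset_Iic.2 hpq).eventuallyLE

lemma distFun_nonneg (hf : IsLogConcaveDensity f) (t : ℝ) : 0 ≤ distFun f t :=
  integral_nonneg hf.nonneg

lemma distFun_le_one (hf : IsLogConcaveDensity f) (t : ℝ) : distFun f t ≤ 1 := by
  rw [← hf.integral_eq_one]
  exact setIntegral_le_integral hf.integrable (ae_of_all _ hf.nonneg)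

lemma exists_distFun_eq (hf : IsLogConcaveDensity f) {p : ℝ} (h0 : 0 < p) (h1 : p < 1) :
    ∃ t, distFun f t = p := by
  have := hf.isProbabilityMeasure
  set ν := volume.withDensity fun x => ENNReal.ofReal (f x)
  have e : ∀ t, cdf ν t = distFun f t := fun t => by rw [cdf_eq_real, hf.withDensity_Iic]
  have h2 := (tendsto_cdf_atBot ν).eventually (gt_mem_nhds h0)
  have h3 := (tendsto_cdf_atTop ν).eventually (lt_mem_nhds h1)
  obtain ⟨s, hs⟩ := h2.exists
  obtain ⟨t, ht⟩ := h3.exists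
  rw [e] at hs ht
  exact mem_range_of_exists_le_of_exists_ge (continuous_distFun hf.integrable)
    ⟨s, hs.le⟩ ⟨t, ht.le⟩

lemma sampleLaw_ae_injective (hf : IsLogConcaveDensity f) (n : ℕ) :
    ∀ᵐ X ∂sampleLaw f n, Function.Injective X := by
  have := hf.isProbabilityMeasure
  have : NullSingletonClass (volume.withDensity fun x => ENNReal.ofReal (f x)) :=
    ⟨fun x => withDensity_absolutelyContinuous _ _ (measure_singleton x)⟩
  exact pi_ae_injective n

lemma sampleLaw_count_le (hf : IsLogConcaveDensity f) (n : ℕ) (t : ℝ) {c : ℝ} (hc : 0 < c) :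
    sampleLaw f n
      {X | c ≤ |((Finset.univ.filter fun i => X i ≤ t).card : ℝ) - n * distFun f t|} ≤
      ENNReal.ofReal (n / (4 * c ^ 2)) := by
  have := hf.isProbabilityMeasure
  have h := pi_count_deviation_le (ν := volume.withDensity fun x => ENNReal.ofReal (f x)) n
    (s := Iic t) measurableSet_Iic hc
  rw [hf.withDensity_Iic] at h
  exact h

/-- The uniform transforms of the order statistics concentrate around `j / n`. -/
lemma sampleLaw_orderStat_le (hf : IsLogConcaveDensity f) {n j : ℕ} (hj : 1 ≤ j) (hjn : j ≤ n)
    {r : ℝ} (hr : 0 < r) :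
    sampleLaw f n {X | r < |distFun f (orderStat X j) - j / n|} ≤
      ENNReal.ofReal (1 / (2 * n * r ^ 2)) := by
  have hn : (0 : ℝ) < n := by exact_mod_cast (by omega : 0 < n)
  have hc : 0 < n * r := by positivity
  have hlow : sampleLaw f n {X | distFun f (orderStat X j) < j / n - r} ≤
      ENNReal.ofReal (n / (4 * (n * r) ^ 2)) := by
    rcases le_or_gt ((j : ℝ) / n - r) 0 with h | h
    · have : {X : Fin n → ℝ | distFun f (orderStat X j) < j / n - r} = ∅ := by
        ext X
        simpa using h.trans (hf.distFun_nonneg _)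
      rw [this]
      simp
    · have hj1 : (j : ℝ) / n ≤ 1 := (div_le_one hn).2 (by exact_mod_cast hjn)
      -- With `F t = j / n - r`, the event forces at least `j` observations into `Iic t`, which
      -- exceeds the expected count by `n r`.
      obtain ⟨t, ht⟩ := hf.exists_distFun_eq h (by linarith)
      refine le_trans (measure_mono fun X hX => ?_) (hf.sampleLaw_count_le n t hc)
      rw [mem_ofPred_eq, ← ht] at hX
      have h1 : orderStat X j ≤ t := by
        by_contra hcon
        exact absurd (hf.distFun_mono (not_le.1 hcon).le) (not_le.2 hX)
      rw [orderStat_le_iff X hj hjn] at h1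
      have h2 : (j : ℝ) ≤ (Finset.univ.filter fun i => X i ≤ t).card := by exact_mod_cast h1
      have h3 : n * distFun f t = j - n * r := by rw [ht]; field_simp
      rw [mem_ofPred_eq, h3]
      exact le_trans (by linarith) (le_abs_self _)
  have hup : sampleLaw f n {X | j / n + r < distFun f (orderStat X j)} ≤
      ENNReal.ofReal (n / (4 * (n * r) ^ 2)) := by
    rcases le_or_gt 1 ((j : ℝ) / n + r) with h | h
    · have : {X : Fin n → ℝ | j / n + r < distFun f (orderStat X j)} = ∅ := by
        ext X
        simpa using (hf.distFun_le_one _).trans h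
      rw [this]
      simp
    · obtain ⟨t, ht⟩ := hf.exists_distFun_eq (by positivity) h
      refine le_trans (measure_mono fun X hX => ?_) (hf.sampleLaw_count_le n t hc)
      rw [mem_ofPred_eq, ← ht] at hX
      have h1 : ¬ orderStat X j ≤ t := fun hcon =>
        absurd (hf.distFun_mono hcon) (not_le.2 hX)
      rw [orderStat_le_iff X hj hjn] at h1
      have h2 : ((Finset.univ.filter fun i => X i ≤ t).card : ℝ) ≤ j := by
        exact_mod_cast (not_le.1 h1).le
      have h3 : n * distFun f t = j + n * r := by rw [ht]; field_simp
      rw [mem_ofPred_eq, h3]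
      exact le_trans (by linarith) (neg_le_abs _)
  have hsub : {X : Fin n → ℝ | r < |distFun f (orderStat X j) - j / n|} ⊆
      {X | distFun f (orderStat X j) < j / n - r} ∪ {X | j / n + r < distFun f (orderStat X j)} := by
    intro X hX
    rw [mem_ofPred_eq] at hX
    rcases lt_abs.1 hX with h | h
    · exact Or.inr (by rw [mem_ofPred_eq]; linarith)
    · exact Or.inl (by rw [mem_ofPred_eq]; linarith)
  refine (measure_mono hsub).trans ((measure_union_le _ _).trans ((add_le_add hlow hup).trans ?_))
  rw [← ENNReal.ofReal_add (by positivity) (by positivity)]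
  refine ENNReal.ofReal_le_ofReal (le_of_eq ?_)
  field_simp
  ring

end IsLogConcaveDensity

end Sample

/-! ### Samples with concentrated order statistics are good -/

lemma designPt_one_add_mul {n : ℕ} (X : Fin n → ℝ) (B i : ℕ) :
    designPt X (1 + i * 2 ^ B) = orderStat X (1 + i * 2 ^ (B + sN n)) := by
  rw [designPt, add_tsub_cancel_left, pow_add, mul_assoc]

/-- The index of the first block endpoint beyond a given level. -/
lemma exists_block_index {p N n : ℝ} (hp : 0 ≤ p) (hN : 0 < N) (hn : 0 < n) :
    ∃ i : ℕ, 1 ≤ i ∧ p < (1 + i * N) / n ∧ ∀ k : ℕ, (1 + ((i + k : ℕ) : ℝ) * N) / n ≤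
      p + (1 + (k + 1) * N) / n := by
  refine ⟨⌊n * p / N⌋₊ + 1, by omega, ?_, fun k => ?_⟩
  · have h := Nat.lt_floor_add_one (n * p / N)
    rw [div_lt_iff₀ hN] at h
    rw [lt_div_iff₀ hn]
    push_cast
    linarith
  · have h := Nat.floor_le (show 0 ≤ n * p / N by positivity)
    rw [le_div_iff₀ hN] at h
    rw [← sub_le_iff_le_add, ← sub_div, div_le_iff₀ hn]
    push_cast
    linarith

lemma exists_goodSample {f : ℝ → ℝ} (hf : IsLogConcaveDensity f) {n B : ℕ} {α : ℝ}
    {X : Fin n → ℝ} {a b u v u' v' ρ r c : ℝ} (hX : Function.Injective X)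
    (hB : (B : ℤ) ≤ Bmax n) (hr : 0 < r) (huv : u ≤ v)
    (hexp : ∀ t ∈ Icc u' v', f t = Real.exp (a + b * t))
    (hdev : ∀ i ≤ numBlock n B, |distFun f (orderStat X (1 + i * 2 ^ (B + sN n))) -
      ((1 + i * 2 ^ (B + sN n) : ℕ) : ℝ) / n| ≤ r)
    (hu : distFun f u' + 2 * r + (1 + 4 * 2 ^ (B + sN n)) / n < distFun f u)
    (hv : distFun f v + 2 * r + (1 + 4 * 2 ^ (B + sN n)) / n < distFun f v')
    (hρ : ρ ≤ 2 ^ (B + sN n) / n - 2 * r)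
    (hc : 2 ^ (B + sN n) / n - c ≤ cB n α B) (hd : dB n α B ≤ 2 ^ (B + sN n) / n + c)
    (hn0 : 0 < n) :
    ∃ i₀ i₁, GoodSample α X a b u v u' v' ρ (2 * r + c) B i₀ i₁ := by
  have hn : (0 : ℝ) < n := by exact_mod_cast hn0
  have hNN : 0 < 2 ^ (B + sN n) := Nat.two_pow_pos _
  obtain ⟨N, hN⟩ : ∃ N : ℕ, N = 2 ^ (B + sN n) := ⟨_, rfl⟩
  have hNr : (2 : ℝ) ^ (B + sN n) = N := by rw [hN]; push_cast; rfl
  have hblock : numBlock n B = (n - 1) / N := by rw [numBlock, hN]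
  have hdes : ∀ i, designPt X (1 + i * 2 ^ B) = orderStat X (1 + i * N) := fun i => by
    rw [designPt_one_add_mul, hN]
  rw [hNr] at hu hv hρ hc hd
  rw [← hN] at hdev hNN
  have hN0 : (0 : ℝ) < N := by exact_mod_cast hNN
  have hF0 := hf.distFun_nonneg
  have hF1 := hf.distFun_le_one
  have hmono := hf.distFun_mono
  -- The first endpoint whose nominal level exceeds `F u'` by the deviation `r` lies beyond `u'`
  -- itself. Two blocks later the level is still small enough to be to the left of `u`.
  obtain ⟨i, hi1, hi2, hi3⟩ := exists_block_index (p := distFun f u' + r) (N := N) (n := n)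
    (by linarith [hF0 u']) hN0 hn
  obtain ⟨e, he1, he2, he3⟩ := exists_block_index (p := distFun f v + r) (N := N) (n := n)
    (by linarith [hF0 v]) hN0 hn
  have hi32 := hi3 2
  have hi33 := hi3 3
  have he32 := he3 2
  have he33 := he3 3
  have h34 : (1 + 3 * (N : ℝ)) / n ≤ (1 + 4 * N) / n := by gcongr; norm_num
  norm_num at hi32 hi33 he32 he33
  have hle : ∀ k : ℕ, (1 + (k : ℝ) * N) / n < 1 → k ≤ numBlock n B := by
    intro k hk
    rw [div_lt_one hn] at hk
    have : 1 + k * N < n := by exact_mod_cast hk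
    rw [hblock, Nat.le_div_iff_mul_le hNN]
    omega
  have hdev' : ∀ k : ℕ, k ≤ numBlock n B →
      (1 + (k : ℝ) * N) / n - r ≤ distFun f (designPt X (1 + k * 2 ^ B)) ∧
      distFun f (designPt X (1 + k * 2 ^ B)) ≤ (1 + (k : ℝ) * N) / n + r := by
    intro k hk
    have h := abs_le.1 (hdev k hk)
    rw [← hdes] at h
    push_cast at h
    constructor <;> linarith [h.1, h.2]
  have hbe3 : e + 3 ≤ numBlock n B := hle _ (by push_cast; linarith [hF1 v'])
  have hbi3 : i + 3 ≤ numBlock n B := hle _ (by push_cast; linarith [hF1 u])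
  have hyi : u' ≤ designPt X (1 + i * 2 ^ B) := by
    by_contra hcon
    have := hmono (not_le.1 hcon).le
    linarith [(hdev' i (by omega)).1]
  have hyi2 : designPt X (1 + (i + 2) * 2 ^ B) ≤ u := by
    by_contra hcon
    have := hmono (not_le.1 hcon).le
    have h2 := (hdev' (i + 2) (by omega)).2
    push_cast at h2
    linarith
  have hye : v < designPt X (1 + e * 2 ^ B) := by
    by_contra hcon
    have := hmono (not_lt.1 hcon)
    linarith [(hdev' e (by omega)).1]
  have hye2 : designPt X (1 + (e + 2) * 2 ^ B) ≤ v' := by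
    by_contra hcon
    have := hmono (not_le.1 hcon).le
    have h2 := (hdev' (e + 2) (by omega)).2
    push_cast at h2
    linarith
  have hnum : ∀ {k : ℕ}, k + 1 ≤ numBlock n B → 1 + k * 2 ^ B + 1 ≤ numPts n :=
    one_add_mul_lt_numPts
  have hlt := designPt_lt hX
  have hymono : ∀ {j k : ℕ}, j ≤ k → k + 1 ≤ numBlock n B →
      designPt X (1 + j * 2 ^ B) ≤ designPt X (1 + k * 2 ^ B) := by
    intro j k hjk hk
    have h1 := hnum hk
    rcases (GoodSample.one_add_mul_mono (B := B) hjk).eq_or_lt with h2 | h2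
    · rw [h2]
    · exact (hlt _ _ (by omega) h2 (by omega)).le
  have hie : i + 2 < e := by
    by_contra hcon
    have := hymono (not_lt.1 hcon) (by omega)
    linarith
  have hmass : ∀ k, i ≤ k → k < e + 2 →
      ∫ t in designPt X (1 + k * 2 ^ B)..designPt X (1 + (k + 1) * 2 ^ B), Real.exp (a + b * t) =
        distFun f (designPt X (1 + (k + 1) * 2 ^ B)) - distFun f (designPt X (1 + k * 2 ^ B)) := by
    intro k hk hk'
    have h1 := hymono (show k ≤ k + 1 by omega) (by omega)
    rw [distFun_sub hf.integrable]
    refine intervalIntegral.integral_congr fun t ht => ?_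
    rw [uIcc_of_le h1] at ht
    exact (hexp t ⟨(hyi.trans (hymono hk (by omega))).trans ht.1,
      ht.2.trans ((hymono (show k + 1 ≤ e + 2 by omega) (by omega)).trans hye2)⟩).symm
  have hmass' : ∀ k, i ≤ k → k < e + 2 → |(∫ t in designPt X (1 + k * 2 ^ B)..
      designPt X (1 + (k + 1) * 2 ^ B), Real.exp (a + b * t)) - N / n| ≤ 2 * r := by
    intro k hk hk'
    rw [hmass k hk hk']
    have h1 := hdev' k (by omega)
    have h2 := hdev' (k + 1) (by omega)
    have h3 : (1 + ((k + 1 : ℕ) : ℝ) * N) / n = (1 + (k : ℝ) * N) / n + N / n := by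
      push_cast; ring
    rw [h3] at h2
    rw [abs_le]
    constructor <;> linarith [h1.1, h1.2, h2.1, h2.2]
  -- Index `e` is the first endpoint surely beyond `v`, and two spare blocks follow it. In `2 * r +
  -- c`, the term `2 * r` is the deviation at the two block ends and `c` the error of the quantile.
  refine ⟨i, e + 2, ⟨hlt, hB, hi1, by omega, by omega, hyi, hye2, hyi2, hye,
    fun k hk hk' => ?_, fun k hk hk' => ?_, fun k hk hk' => ?_, fun k hk hk' => ?_⟩⟩
  · linarith [(abs_le.1 (hmass' k hk hk')).1]
  · rw [hmass k hk hk']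
    linarith [hF1 (designPt X (1 + (k + 1) * 2 ^ B)), hF0 (designPt X (1 + k * 2 ^ B))]
  · linarith [(abs_le.1 (hmass' k hk hk')).2]
  · linarith [(abs_le.1 (hmass' k hk hk')).1]

/-! ### Asymptotics of the levels and quantiles -/

lemma tendsto_log_nat : Tendsto (fun n : ℕ => Real.log n) atTop atTop :=
  Real.tendsto_log_atTop.comp tendsto_natCast_atTop_atTop

lemma tendsto_log_log_nat : Tendsto (fun n : ℕ => Real.log (Real.log n)) atTop atTop :=
  Real.tendsto_log_atTop.comp tendsto_log_nat

lemma eventually_mul_log_le (c : ℝ) : ∀ᶠ n : ℕ in atTop, c * Real.log n ≤ n := by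
  have h := (Real.isLittleO_log_id_atTop.comp_tendsto tendsto_natCast_atTop_atTop :
    (fun n : ℕ => Real.log n) =o[atTop] fun n : ℕ => (n : ℝ))
  have h2 := h.bound (show 0 < (|c| + 1)⁻¹ by positivity)
  filter_upwards [h2, tendsto_log_nat.eventually_ge_atTop 0] with n hn hn0
  simp only [Function.comp_apply, Real.norm_eq_abs, id, abs_of_nonneg hn0, Nat.abs_cast] at hn
  rw [inv_mul_eq_div, le_div_iff₀ (by positivity)] at hn
  nlinarith [le_abs_self c, mul_le_mul_of_nonneg_right (le_abs_self c) hn0]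

lemma tendsto_rateN : Tendsto rateN atTop (𝓝 0) := by
  have h : Tendsto (fun n : ℕ => Real.log (Real.log n) / n) atTop (𝓝 0) := by
    have h1 : Tendsto (fun n : ℕ => Real.log n / n) atTop (𝓝 0) :=
      (Real.isLittleO_log_id_atTop.comp_tendsto tendsto_natCast_atTop_atTop :
        (fun n : ℕ => Real.log n) =o[atTop] fun n : ℕ => (n : ℝ)).tendsto_div_nhds_zero
    refine tendsto_of_tendsto_of_tendsto_of_le_of_le' tendsto_const_nhds h1 ?_ ?_
    · filter_upwards [tendsto_log_log_nat.eventually_ge_atTop 0] with n hn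
      positivity
    · filter_upwards [tendsto_log_nat.eventually_gt_atTop 0] with n hn
      exact div_le_div_of_nonneg_right (by linarith [Real.log_le_sub_one_of_pos hn])
        n.cast_nonneg
  have h2 := (Real.continuous_sqrt.tendsto 0).comp h
  rw [Real.sqrt_zero] at h2
  exact h2

/-- The block level `B_max - K`. -/
noncomputable def subLevel (K n : ℕ) : ℕ := (Bmax n - K).toNat

lemma logb_two_le {x : ℝ} (hx : 0 ≤ Real.log x) : Real.logb 2 x ≤ 2 * Real.log x := by
  rw [Real.logb, div_le_iff₀ (Real.log_pos one_lt_two)]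
  nlinarith [Real.log_two_gt_d9]

lemma eventually_le_Bmax (K : ℕ) : ∀ᶠ n : ℕ in atTop, (K : ℤ) ≤ Bmax n := by
  filter_upwards [eventually_mul_log_le (8 * 2 ^ (K + 2)), tendsto_log_nat.eventually_ge_atTop 1,
    eventually_gt_atTop 0] with n h1 h2 h3
  have hn : (0 : ℝ) < n := by exact_mod_cast h3
  have hs : (sN n : ℝ) < Real.logb 2 (Real.log n) + 1 :=
    Nat.ceil_lt_add_one (Real.logb_nonneg one_lt_two h2)
  have h4 : Real.logb 2 (Real.log n) + (K + 2 : ℕ) ≤ Real.logb 2 (n / 8) := by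
    rw [Real.le_logb_iff_rpow_le one_lt_two (by positivity), Real.rpow_add two_pos,
      Real.rpow_logb two_pos (by norm_num) (by linarith), Real.rpow_natCast]
    rw [le_div_iff₀ (by norm_num)]
    linarith
  have h5 : (((sN n : ℤ) + K : ℤ) : ℝ) ≤ Real.logb 2 (n / 8) := by
    push_cast at h4 ⊢
    linarith
  have h6 := Int.le_floor.2 h5
  rw [Bmax]
  omega

lemma subLevel_le {K n : ℕ} (h : (K : ℤ) ≤ Bmax n) : ((subLevel K n : ℕ) : ℤ) ≤ Bmax n := by
  rw [subLevel]; omega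

/-- In `subLevel K n + sN n` the quantity `s_n` cancels, leaving `⌊log₂ (n / 8)⌋ - K`; the factor
two between the bounds comes from the floor. -/
lemma two_pow_subLevel {K n : ℕ} (h : (K : ℤ) ≤ Bmax n) (hn0 : 0 < n) :
    (n : ℝ) / (16 * 2 ^ K) ≤ 2 ^ (subLevel K n + sN n) ∧
      (2 : ℝ) ^ (subLevel K n + sN n) ≤ n / (8 * 2 ^ K) := by
  have hn : (0 : ℝ) < n := by exact_mod_cast hn0
  have h1 : ((subLevel K n + sN n + K : ℕ) : ℤ) = ⌊Real.logb 2 ((n : ℝ) / 8)⌋ := by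
    rw [subLevel]
    have : Bmax n = ⌊Real.logb 2 ((n : ℝ) / 8)⌋ - (sN n : ℤ) := rfl
    push_cast
    omega
  have h2 := Int.floor_le (Real.logb 2 ((n : ℝ) / 8))
  have h3 := Int.lt_floor_add_one (Real.logb 2 ((n : ℝ) / 8))
  rw [← h1, Int.cast_natCast] at h2 h3
  rw [Real.le_logb_iff_rpow_le one_lt_two (by positivity), Real.rpow_natCast, pow_add] at h2
  rw [Real.logb_lt_iff_lt_rpow one_lt_two (by positivity), Real.rpow_add two_pos,
    Real.rpow_natCast, Real.rpow_one, pow_add] at h3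
  constructor
  · rw [div_le_iff₀ (by positivity)]
    linarith
  · rw [le_div_iff₀ (by positivity)]
    linarith

lemma numBlock_subLevel_le {K n : ℕ} (h : (K : ℤ) ≤ Bmax n) (hn0 : 0 < n) :
    numBlock n (subLevel K n) ≤ 16 * 2 ^ K := by
  have h1 := (two_pow_subLevel h hn0).1
  rw [div_le_iff₀ (by positivity)] at h1
  have h2 : n ≤ 2 ^ (subLevel K n + sN n) * (16 * 2 ^ K) := by exact_mod_cast h1
  rw [numBlock]
  exact Nat.div_le_of_le_mul (by omega)

lemma one_le_numBlock_subLevel {K n : ℕ} (h : (K : ℤ) ≤ Bmax n) (hn : 2 ≤ n) :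
    1 ≤ numBlock n (subLevel K n) := by
  have h1 := (two_pow_subLevel h (by omega)).2
  rw [le_div_iff₀ (by positivity)] at h1
  have h2 : 2 ^ (subLevel K n + sN n) * (8 * 2 ^ K) ≤ n := by exact_mod_cast h1
  have h3 : 1 ≤ 2 ^ K := Nat.one_le_two_pow
  rw [numBlock, Nat.le_div_iff_mul_le (Nat.two_pow_pos _)]
  have h4 : 2 ^ (subLevel K n + sN n) * 8 ≤ 2 ^ (subLevel K n + sN n) * (8 * 2 ^ K) :=
    Nat.mul_le_mul_left _ (by omega)
  omega

lemma Bmax_add_two_le {n : ℕ} (hn : 0 ≤ Real.log n) (hn0 : 0 < n) :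
    ((Bmax n : ℤ) : ℝ) + 2 ≤ 2 * Real.log n := by
  have hn' : (0 : ℝ) < n := by exact_mod_cast hn0
  have h1 := Int.floor_le (Real.logb 2 ((n : ℝ) / 8))
  have h2 : Real.logb 2 ((n : ℝ) / 8) = Real.logb 2 n - 3 := by
    rw [Real.logb_div hn'.ne' (by norm_num)]
    congr 1
    rw [show (8 : ℝ) = 2 ^ (3 : ℝ) by norm_num, Real.logb_rpow two_pos (by norm_num)]
  have h3 := logb_two_le hn
  rw [Bmax]
  push_cast
  linarith [Nat.cast_nonneg (α := ℝ) (sN n)]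

lemma tN_bounds {n : ℕ} (h : 0 ≤ Bmax n) :
    1 / 2 ≤ tN n ∧ tN n ≤ ((Bmax n : ℤ) : ℝ) + 1 := by
  constructor
  · rw [tN]
    refine le_trans ?_ (Finset.single_le_sum
      (f := fun B : ℕ => 1 / ((B : ℝ) + 2)) (fun _ _ => by positivity)
      (Finset.mem_range.2 (show 0 < (Bmax n + 1).toNat by omega)))
    norm_num
  · have h1 : (((Bmax n + 1).toNat : ℕ) : ℝ) = ((Bmax n : ℤ) : ℝ) + 1 := by
      have : (((Bmax n + 1).toNat : ℕ) : ℤ) = Bmax n + 1 := Int.toNat_of_nonneg (by omega)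
      exact_mod_cast congrArg (Int.cast : ℤ → ℝ) this
    rw [tN, ← h1]
    refine (Finset.sum_le_card_nsmul _ _ 1 fun B _ => ?_).trans (by simp)
    rw [div_le_one (by positivity)]
    linarith [Nat.cast_nonneg (α := ℝ) B]

/-- Both `B + 2` and `t_n` are at most `2 log n` and the number of blocks is bounded. That the level
is only polynomially small in `log n` is the source of the iterated logarithm in the rate. -/
lemma levelB_subLevel {K n : ℕ} {α : ℝ} (hα : α ∈ Ioo (0 : ℝ) 1) (h : (K : ℤ) ≤ Bmax n)
    (hn2 : 2 ≤ n) :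
    α / (128 * 2 ^ K * Real.log n ^ 2) ≤ levelB n α (subLevel K n) ∧
      levelB n α (subLevel K n) < 1 := by
  have hlog : 0 < Real.log n := Real.log_pos (by exact_mod_cast hn2)
  obtain ⟨ht1, ht2⟩ := tN_bounds (n := n) (by omega)
  have hB := Bmax_add_two_le hlog.le (by omega)
  have hs : ((subLevel K n : ℕ) : ℝ) ≤ ((Bmax n : ℤ) : ℝ) := by exact_mod_cast subLevel_le h
  have hs0 := Nat.cast_nonneg (α := ℝ) (subLevel K n)
  have hb1 : (1 : ℝ) ≤ numBlock n (subLevel K n) := by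
    exact_mod_cast one_le_numBlock_subLevel h hn2
  have hb2 : (numBlock n (subLevel K n) : ℝ) ≤ 16 * 2 ^ K := by
    exact_mod_cast numBlock_subLevel_le h (by omega)
  rw [levelB]
  constructor
  · refine div_le_div_of_nonneg_left hα.1.le (by positivity) ?_
    calc 2 * ((subLevel K n : ℝ) + 2) * (numBlock n (subLevel K n) : ℝ) * tN n
        ≤ 2 * (2 * Real.log n) * (16 * 2 ^ K) * (2 * Real.log n) := by
          gcongr <;> linarith
      _ = 128 * 2 ^ K * Real.log n ^ 2 := by ring
  · rw [div_lt_one (by positivity)]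
    have h1 : 2 * (0 + 2) * 1 * (1 / 2) ≤
        2 * ((subLevel K n : ℝ) + 2) * (numBlock n (subLevel K n) : ℝ) * tN n := by
      gcongr
    linarith [hα.2]

lemma rateN_sq {n : ℕ} (h : 0 ≤ Real.log (Real.log n)) :
    rateN n ^ 2 = Real.log (Real.log n) / n := by
  rw [rateN, Real.sq_sqrt (by positivity)]

lemma eventually_quantile (K : ℕ) {α : ℝ} (hα : α ∈ Ioo (0 : ℝ) 1) :
    ∀ᶠ n : ℕ in atTop,
      2 ^ (subLevel K n + sN n) / n - (23 * 2 ^ K + 1) * rateN n ≤ cB n α (subLevel K n) ∧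
      dB n α (subLevel K n) ≤ 2 ^ (subLevel K n + sN n) / n + (23 * 2 ^ K + 1) * rateN n := by
  have hsmall : ∀ᶠ n in atTop, 23 * 2 ^ K * rateN n ≤ 1 := by
    have := tendsto_rateN.const_mul (23 * 2 ^ K)
    rw [mul_zero] at this
    exact this.eventually (ge_mem_nhds zero_lt_one)
  filter_upwards [eventually_le_Bmax K, eventually_ge_atTop 2, hsmall,
    tendsto_log_log_nat.eventually_ge_atTop 1, tendsto_log_nat.eventually_ge_atTop 1,
    tendsto_log_nat.eventually_gt_atTop (256 * 2 ^ K / α)] with n hK hn2 hε hw hlog hlogα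
  have hn : (0 : ℝ) < n := by exact_mod_cast (by omega : 0 < n)
  obtain ⟨hN1, hN2⟩ := two_pow_subLevel hK (by omega)
  obtain ⟨hl1, hl2⟩ := levelB_subLevel hα hK hn2
  set N : ℝ := 2 ^ (subLevel K n + sN n) with hN
  set δ := levelB n α (subLevel K n) with hδ
  set w := Real.log (Real.log n) with hwdef
  set r := rateN n with hrdef
  have hr0 : 0 ≤ r := Real.sqrt_nonneg _
  have hr2 : r ^ 2 = w / n := rateN_sq (by linarith)
  have hK1 : (1 : ℝ) ≤ 2 ^ K := one_le_pow₀ one_le_two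
  have hN0 : 0 < N := by positivity
  have hNn : N ≤ n / 8 := by
    refine hN2.trans ?_
    gcongr
    linarith
  have hb : 0 < (n : ℝ) + 1 - N := by linarith
  have hr1 : 1 / (n : ℝ) ≤ r := by
    refine Real.le_sqrt_of_sq_le ?_
    rw [one_div, inv_pow, inv_le_comm₀ (by positivity) (by positivity), inv_div]
    have h1 : (1 : ℝ) ≤ n := by exact_mod_cast (by omega : 1 ≤ n)
    calc (n : ℝ) / w ≤ n := div_le_self hn.le hw
      _ ≤ n ^ 2 := by nlinarith
  -- The Chernoff exponent `ε ^ 2 * N / 8` must reach `4 w`, for which `23 ^ 2 ≥ 512` suffices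
  -- because `N ≥ n / (16 * 2 ^ K)`.
  set ε := 23 * 2 ^ K * r with hεdef
  have hε0 : 0 ≤ ε := by positivity
  have hεN : 4 * w ≤ ε ^ 2 * N / 8 := by
    have h1 : ε ^ 2 * (n / (16 * 2 ^ K)) ≤ ε ^ 2 * N := by gcongr
    have h2 : ε ^ 2 * (n / (16 * 2 ^ K)) = 529 / 16 * 2 ^ K * w := by
      rw [hεdef, mul_pow, hr2]; field_simp; norm_num
    nlinarith
  -- The tail is of order `(log n)⁻⁴`, eventually below the level of order `α (log n)⁻²`. Only the
  -- threshold for `n` depends on `α`.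
  have hlev : Real.exp (1 / 4 - 4 * w) < δ := by
    refine lt_of_lt_of_le ?_ hl1
    have h1 : Real.exp (4 * w) = Real.log n ^ 4 := by
      rw [show (4 : ℝ) * w = (4 : ℕ) * w by norm_num, Real.exp_nat_mul, hwdef,
        Real.exp_log (by linarith)]
    have h2 : Real.exp (1 / 4) ≤ 2 := by
      have := exp_half_le_one_add (ε := 1 / 2) (by norm_num) (by norm_num)
      norm_num at this ⊢
      linarith
    rw [Real.exp_sub, h1, div_lt_div_iff₀ (by positivity) (by positivity)]
    rw [div_lt_iff₀ hα.1] at hlogα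
    have h3 : 256 * 2 ^ K < α * Real.log n ^ 2 := by
      nlinarith [mul_le_mul_of_nonneg_left hlog (mul_nonneg hα.1.le (by linarith : 0 ≤ Real.log n))]
    have hL2 : 0 < Real.log n ^ 2 := by positivity
    calc Real.exp (1 / 4) * (128 * 2 ^ K * Real.log n ^ 2)
        ≤ 2 * (128 * 2 ^ K * Real.log n ^ 2) := by gcongr
      _ = (256 * 2 ^ K) * Real.log n ^ 2 := by ring
      _ < (α * Real.log n ^ 2) * Real.log n ^ 2 := by gcongr
      _ = α * Real.log n ^ 4 := by ring
  have hsum : N + ((n : ℝ) + 1 - N) = n + 1 := by ring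
  have hsum' : ((n : ℝ) + 1 - N) + N = n + 1 := by ring
  have hp1 : N / (n + 1) ≤ N / n := by gcongr; linarith
  -- The beta mean is `N / (n + 1)` rather than `N / n`. The difference is at most `1 / n ≤ r` and
  -- accounts for the `+ 1` in the constant.
  have hp2 : N / n - 1 / n ≤ N / (n + 1) := by
    rw [← sub_div, div_le_div_iff₀ hn (by positivity)]
    nlinarith
  have hp3 : N / (n + 1) ≤ 1 := by rw [div_le_one (by positivity)]; linarith
  constructor
  · have hεb : ε ^ 2 * N / 8 ≤ ε ^ 2 * ((n : ℝ) + 1 - N) / 8 := by gcongr; linarith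
    have h := le_qBeta hN0 hb hε0 hε hl2
      (lt_of_le_of_lt (Real.exp_le_exp.2 (by linarith)) hlev)
    rw [hsum'] at h
    rw [cB]
    refine le_trans ?_ h
    have e : ((n : ℝ) + 1 - N) / (n + 1) = 1 - N / (n + 1) := by field_simp
    rw [e]
    have : 0 ≤ N / (n + 1) * ε := by positivity
    linarith
  · have h := qBeta_le hN0 hb hε0 hε hl2 (le_trans (Real.exp_le_exp.2 (by linarith)) hlev.le)
    rw [hsum] at h
    rw [dB]
    refine h.trans ?_
    have : N / (n + 1) * ε ≤ 1 * ε := by gcongr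
    linarith

/-! ### The rate of the band -/

lemma exists_exp_bounds (a b u' v' : ℝ) : ∃ m₀ M₀ : ℝ, 0 < m₀ ∧ 0 < M₀ ∧
    (∀ t ∈ Icc u' v', m₀ ≤ Real.exp (a + b * t)) ∧
    ∀ t ∈ Icc u' v', Real.exp (a + b * t) ≤ M₀ := by
  have hb : ∀ t ∈ Icc u' v', |b * t| ≤ |b| * (|u'| + |v'|) := fun t ht => by
    rw [abs_mul]
    refine mul_le_mul_of_nonneg_left (abs_le.2 ⟨?_, ?_⟩) (abs_nonneg _)
    · linarith [ht.1, neg_abs_le u', abs_nonneg v']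
    · linarith [ht.2, le_abs_self v', abs_nonneg u']
  refine ⟨Real.exp (a - |b| * (|u'| + |v'|)), Real.exp (a + |b| * (|u'| + |v'|)),
    Real.exp_pos _, Real.exp_pos _, fun t ht => Real.exp_le_exp.2 ?_,
    fun t ht => Real.exp_le_exp.2 ?_⟩
  · linarith [(abs_le.1 (hb t ht)).1]
  · linarith [(abs_le.1 (hb t ht)).2]

/-- The samples with ties, or with a block endpoint that is not concentrated. -/
def badSamples (f : ℝ → ℝ) (B n : ℕ) : Set (Fin n → ℝ) :=
  {X | ¬ Function.Injective X} ∪ ⋃ i ∈ Finset.range (numBlock n B + 1),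
    {X | rateN n < |distFun f (orderStat X (1 + i * 2 ^ (B + sN n))) -
      ((1 + i * 2 ^ (B + sN n) : ℕ) : ℝ) / n|}

/-- A union bound over boundedly many endpoints. Since `n * rateN n ^ 2 = log log n`, each of them
fails with probability at most `1 / (2 log log n)`. -/
lemma IsLogConcaveDensity.tendsto_badSamples {f : ℝ → ℝ} (hf : IsLogConcaveDensity f) (K : ℕ) :
    Tendsto (fun n => sampleLaw f n (badSamples f (subLevel K n) n)) atTop (𝓝 0) := by
  have hlim : Tendsto (fun n : ℕ => ((16 * 2 ^ K + 1 : ℕ) : ENNReal) *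
      ENNReal.ofReal (1 / (2 * Real.log (Real.log n)))) atTop (𝓝 0) := by
    have h1 : Tendsto (fun n : ℕ => 1 / (2 * Real.log (Real.log n))) atTop (𝓝 0) :=
      (tendsto_log_log_nat.const_mul_atTop two_pos).const_div_atTop 1
    have h2 := ENNReal.tendsto_ofReal h1
    rw [ENNReal.ofReal_zero] at h2
    have h3 := ENNReal.Tendsto.const_mul (a := ((16 * 2 ^ K + 1 : ℕ) : ENNReal)) h2
      (Or.inr (ENNReal.natCast_ne_top _))
    rwa [mul_zero] at h3
  refine tendsto_of_tendsto_of_tendsto_of_le_of_le' tendsto_const_nhds hlim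
    (Eventually.of_forall fun _ => zero_le) ?_
  filter_upwards [eventually_le_Bmax K, eventually_ge_atTop 2,
    tendsto_log_log_nat.eventually_gt_atTop 0] with n hK hn2 hw
  have hn : (0 : ℝ) < n := by exact_mod_cast (by omega : 0 < n)
  have hr : 0 < rateN n := Real.sqrt_pos.2 (by positivity)
  have hnull : sampleLaw f n {X | ¬ Function.Injective X} = 0 :=
    ae_iff.1 (hf.sampleLaw_ae_injective n)
  refine (measure_union_le _ _).trans ?_
  rw [hnull, zero_add]
  refine (measure_biUnion_finset_le _ _).trans ?_
  have hterm : ∀ i ∈ Finset.range (numBlock n (subLevel K n) + 1),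
      sampleLaw f n {X | rateN n < |distFun f (orderStat X (1 + i * 2 ^ (subLevel K n + sN n))) -
        ((1 + i * 2 ^ (subLevel K n + sN n) : ℕ) : ℝ) / n|} ≤
      ENNReal.ofReal (1 / (2 * Real.log (Real.log n))) := by
    intro i hi
    rw [Finset.mem_range] at hi
    have h1 : i * 2 ^ (subLevel K n + sN n) ≤ n - 1 :=
      (Nat.mul_le_mul_right _ (by omega : i ≤ numBlock n (subLevel K n))).trans
        (Nat.div_mul_le_self _ _)
    refine (hf.sampleLaw_orderStat_le (by omega) (by omega) hr).trans
      (ENNReal.ofReal_le_ofReal (le_of_eq ?_))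
    rw [rateN_sq hw.le]
    field_simp
  refine (Finset.sum_le_card_nsmul _ _ _ hterm).trans ?_
  rw [Finset.card_range, nsmul_eq_mul]
  refine mul_le_mul_left (Nat.cast_le.2 ?_) _
  have := numBlock_subLevel_le hK (by omega)
  omega

lemma IsLogConcaveDensity.distFun_lt {f : ℝ → ℝ} (hf : IsLogConcaveDensity f) {p q : ℝ}
    (hpq : p < q) (hpos : ∀ t ∈ Icc p q, 0 < f t) : distFun f p < distFun f q := by
  have := intervalIntegral.intervalIntegral_pos_of_pos_on hf.integrable.intervalIntegrable
    (fun t ht => hpos t (Ioo_subset_Icc_self ht)) hpq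
  rw [← distFun_sub hf.integrable] at this
  linarith

lemma eventually_mul_rateN_le (c : ℝ) {d : ℝ} (hd : 0 < d) :
    ∀ᶠ n in atTop, c * rateN n ≤ d := by
  have := tendsto_rateN.const_mul c
  rw [mul_zero] at this
  exact this.eventually (ge_mem_nhds hd)

/-- Off a set of vanishing probability, the band is within `C * rateN n` of the density. -/
lemma exists_band_rate {f : ℝ → ℝ} (hf : IsLogConcaveDensity f) {a b u v u' v' : ℝ} (hu : u' < u)
    (huv : u ≤ v) (hv : v < v') (hexp : ∀ t ∈ Icc u' v', f t = Real.exp (a + b * t)) :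
    ∃ C : ℝ, 0 < C ∧ ∃ K : ℕ, ∀ α ∈ Ioo (0 : ℝ) 1, ∀ᶠ n in atTop,
      ∀ X ∉ badSamples f (subLevel K n) n, HasFeasible α X → ∀ t ∈ Icc u v,
        ∃ lo up : ℝ, lowerBand α X t = lo ∧ upperBand α X t = up ∧
          |lo - f t| ≤ C * rateN n ∧ |up - f t| ≤ C * rateN n := by
  obtain ⟨m₀, M₀, hm₀, hM₀, hm, hM⟩ := exists_exp_bounds a b u' v'
  have hpos : ∀ t ∈ Icc u' v', 0 < f t := fun t ht => by rw [hexp t ht]; exact Real.exp_pos _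
  have hFu := hf.distFun_lt hu fun t ht => hpos t ⟨ht.1, by linarith [ht.2]⟩
  have hFv := hf.distFun_lt hv fun t ht => hpos t ⟨by linarith [ht.1], ht.2⟩
  obtain ⟨η, hη, hη1, hη2⟩ : ∃ η, 0 < η ∧ distFun f u' + η ≤ distFun f u ∧
      distFun f v + η ≤ distFun f v' :=
    ⟨min (distFun f u - distFun f u') (distFun f v' - distFun f v),
      lt_min (sub_pos.2 hFu) (sub_pos.2 hFv),
      by linarith [min_le_left (distFun f u - distFun f u') (distFun f v' - distFun f v)],
      by linarith [min_le_right (distFun f u - distFun f u') (distFun f v' - distFun f v)]⟩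
  -- Four blocks then have nominal mass below `η / 2`, so the spare blocks fit between `u'` and `u`
  -- and between `v` and `v'`.
  obtain ⟨K, hK⟩ := exists_pow_lt_of_lt_one hη (show (1 / 2 : ℝ) < 1 by norm_num)
  -- Half of the smallest possible nominal block mass; the other half absorbs the deviation `2 *
  -- rateN n`.
  set ρ : ℝ := 1 / (32 * 2 ^ K) with hρ
  have hρ0 : 0 < ρ := by positivity
  have huv' : 0 < v' - u' := by linarith
  have hbc : 0 < bandConst m₀ M₀ ρ u' v' := by rw [bandConst, nodeConst]; positivity
  refine ⟨2 * M₀ * (bandConst m₀ M₀ ρ u' v' * (23 * 2 ^ K + 3)), by positivity, K,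
    fun α hα => ?_⟩
  have hinv : ∀ᶠ n : ℕ in atTop, 1 / (n : ℝ) ≤ η / 4 :=
    tendsto_one_div_atTop_nhds_zero_nat.eventually (ge_mem_nhds (by positivity))
  filter_upwards [eventually_le_Bmax K, eventually_ge_atTop 2, eventually_quantile K hα,
    tendsto_log_log_nat.eventually_gt_atTop 0, hinv,
    eventually_mul_rateN_le 2 (show 0 < η / 4 by positivity), eventually_mul_rateN_le 2 hρ0,
    eventually_mul_rateN_le (2 * (23 * 2 ^ K + 3)) hρ0,
    eventually_mul_rateN_le (bandConst m₀ M₀ ρ u' v' * (23 * 2 ^ K + 3)) one_pos]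
    with n hBK hn2 hquant hw h1n hrη hrρ hκρ hκ1 X hX hfe t ht
  have hn : (0 : ℝ) < n := by exact_mod_cast (by omega : 0 < n)
  have hr : 0 < rateN n := Real.sqrt_pos.2 (by positivity)
  rw [badSamples, mem_union, not_or] at hX
  obtain ⟨hinj, hdev⟩ := hX
  have hinj' : Function.Injective X := by simpa using hinj
  have hdev' : ∀ i ≤ numBlock n (subLevel K n),
      |distFun f (orderStat X (1 + i * 2 ^ (subLevel K n + sN n))) -
        ((1 + i * 2 ^ (subLevel K n + sN n) : ℕ) : ℝ) / n| ≤ rateN n := by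
    intro i hi
    by_contra hcon
    exact hdev (mem_biUnion (show i ∈ Finset.range (numBlock n (subLevel K n) + 1) by
      simpa using Nat.lt_succ_of_le hi) (not_le.1 hcon))
  obtain ⟨hN1, hN2⟩ := two_pow_subLevel hBK (by omega)
  have hN1' : 2 * ρ ≤ 2 ^ (subLevel K n + sN n) / n := by
    rw [le_div_iff₀ hn, hρ]
    refine le_trans (le_of_eq ?_) hN1
    field_simp
    norm_num
  have hN2' : (4 : ℝ) * 2 ^ (subLevel K n + sN n) / n < η / 2 := by
    have h1 : (4 : ℝ) * 2 ^ (subLevel K n + sN n) / n ≤ (1 / 2) ^ K / 2 := by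
      rw [div_le_iff₀ hn]
      refine (mul_le_mul_of_nonneg_left hN2 (by norm_num)).trans (le_of_eq ?_)
      rw [one_div, inv_pow]
      field_simp
      norm_num
    linarith
  have hgap : (1 + 4 * 2 ^ (subLevel K n + sN n)) / (n : ℝ) =
      1 / n + 4 * 2 ^ (subLevel K n + sN n) / n := add_div _ _ _
  obtain ⟨i₀, i₁, hgood⟩ := exists_goodSample hf (ρ := ρ) (u := u) (v := v) hinj'
    (subLevel_le hBK) hr huv hexp hdev' (by linarith) (by linarith) (by linarith) hquant.1
    hquant.2 (by omega)
  have e : 2 * rateN n + (23 * 2 ^ K + 1) * rateN n = (23 * 2 ^ K + 3) * rateN n := by ring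
  rw [e] at hgood
  obtain ⟨lo, up, h1, h2, h3, h4⟩ := hgood.band hfe hρ0 (by positivity) (by linarith) hu.le hv.le
    hm₀ hM₀ hm hM (by linarith) ht
  rw [← hexp t ⟨hu.le.trans ht.1, ht.2.trans hv.le⟩] at h3 h4
  exact ⟨lo, up, h1, h2, h3.trans (le_of_eq (by ring)), h4.trans (le_of_eq (by ring))⟩

lemma tendsto_measure_of_eventually_subset {f : ℝ → ℝ} {S T : ∀ n : ℕ, Set (Fin n → ℝ)}
    (hT : Tendsto (fun n => sampleLaw f n (T n)) atTop (𝓝 0))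
    (h : ∀ᶠ n in atTop, ∀ X ∉ T n, X ∉ S n) :
    Tendsto (fun n => sampleLaw f n (S n)) atTop (𝓝 0) := by
  refine tendsto_of_tendsto_of_tendsto_of_le_of_le' tendsto_const_nhds hT
    (Eventually.of_forall fun _ => zero_le) ?_
  filter_upwards [h] with n hn
  exact measure_mono fun X hX => by_contra fun hcon => hn X hcon hX

theorem theorem1 (f : ℝ → ℝ) (hf : IsLogConcaveDensity f)
    (J : Set ℝ) (hJ : J.OrdConnected)
    (hlin : ∃ a b : ℝ, ∀ x ∈ J, 0 < f x ∧ Real.log (f x) = a + b * x)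
    (u v : ℝ) (hI : Icc u v ⊆ interior J) :
    ∃ C : ℝ, 0 < C ∧ ∀ α ∈ Ioo (0 : ℝ) 1,
      Tendsto (fun n : ℕ => sampleLaw f n {X | HasFeasible α X ∧
        ¬ (⨆ x ∈ Icc u v, (upperBand α X x - (f x : EReal)).abs) ≤ ENNReal.ofReal (C * rateN n)})
        atTop (𝓝 0) ∧
      Tendsto (fun n : ℕ => sampleLaw f n {X | HasFeasible α X ∧
        ¬ (⨆ x ∈ Icc u v, (lowerBand α X x - (f x : EReal)).abs) ≤ ENNReal.ofReal (C * rateN n)})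
        atTop (𝓝 0) ∧
      Tendsto (fun n : ℕ => sampleLaw f n {X | HasFeasible α X ∧
        ¬ (⨆ x ∈ Icc u v, (upperBand α X x - lowerBand α X x)) ≤ ((2 * C * rateN n : ℝ) : EReal)})
        atTop (𝓝 0) := by
  rcases lt_or_ge v u with huv | huv
  -- For an empty interval the suprema are the bottom elements, so the events are empty.
  · refine ⟨1, one_pos, fun α _ => ?_⟩
    simp [Icc_eq_empty (not_le.2 huv)]
  obtain ⟨a, b, hab⟩ := hlin
  obtain ⟨u', hu', huJ⟩ : ∃ u' < u, u' ∈ J := by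
    have h1 := mem_interior_iff_mem_nhds.1 (hI (left_mem_Icc.2 huv))
    obtain ⟨w, hw, hwJ⟩ := exists_Ioc_subset_of_mem_nhds h1 ⟨u - 1, by linarith⟩
    exact ⟨(w + u) / 2, by linarith, hwJ ⟨by linarith, by linarith⟩⟩
  obtain ⟨v', hv', hvJ⟩ : ∃ v' > v, v' ∈ J := by
    have h1 := mem_interior_iff_mem_nhds.1 (hI (right_mem_Icc.2 huv))
    obtain ⟨w, hw, hwJ⟩ := exists_Ico_subset_of_mem_nhds h1 ⟨v + 1, by linarith⟩
    exact ⟨(v + w) / 2, by linarith, hwJ ⟨by linarith, by linarith⟩⟩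
  have hexp : ∀ t ∈ Icc u' v', f t = Real.exp (a + b * t) := fun t ht => by
    obtain ⟨h1, h2⟩ := hab t (hJ.out huJ hvJ ht)
    rw [← h2, Real.exp_log h1]
  obtain ⟨C, hC, K, hrate⟩ := exists_band_rate hf hu' huv hv' hexp
  refine ⟨C, hC, fun α hα => ⟨?_, ?_, ?_⟩⟩ <;>
    refine tendsto_measure_of_eventually_subset (hf.tendsto_badSamples K) ?_ <;>
    filter_upwards [hrate α hα] with n hn X hX ⟨hfe, hcon⟩ <;>
    refine hcon (iSup₂_le fun t ht => ?_) <;>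
    obtain ⟨lo, up, hlo, hup, h1, h2⟩ := hn X hX hfe t ht
  · rw [hup, ← EReal.coe_sub, EReal.abs_def]
    exact ENNReal.ofReal_le_ofReal h2
  · rw [hlo, ← EReal.coe_sub, EReal.abs_def]
    exact ENNReal.ofReal_le_ofReal h1
  · rw [hup, hlo, ← EReal.coe_sub]
    refine EReal.coe_le_coe_iff.2 ?_
    linarith [(abs_le.1 h1).1, (abs_le.1 h2).2]
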